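/- All rings are commutative with unit. A pair $(A,I)$ is a ring $A$ with an ideal $I$, and a morphism of pairs $u:(A,I)\to(B,J)$ is a ring homomorphism $u:A\to B$ with $u^{-1}(J)=I$. The pair $(A,I)$ is henselian if $I$ lies in the Jacobson radical of $A$ and every étale $A$-algebra $A'$ for which $A/I\to A'\otimes_A A/I$ is an isomorphism admits an $A$-algebra homomorphism $A'\to A$. The henselization of a pair is the universal morphism of pairs from it to a henselian pair. $\widehat A$ denotes the $I$-adic completion of $A$. For a henselian pair $(A,I)$, consider the approximation assertion: for every finitely presented $A$-algebra $B$, every open $V\subset\operatorname{Spec}B$ that is smooth over $\operatorname{Spec}A$, every $n\ge 0$, and every $\widehat A$-section $\overline\varepsilon:\operatorname{Spec}\widehat A\to\operatorname{Spec}(B\otimes_A\widehat A)$ whose restriction to $\operatorname{Spec}\widehat A\setminus V(I\widehat A)$ factors through the preimage of $V$, there is an $A$-section $\varepsilon:\operatorname{Spec}A\to\operatorname{Spec}B$, congruent to $\overline\varepsilon$ modulo $I^n$, whose restriction to $\operatorname{Spec}A\setminus V(I)$ factors through $V$. (Elkik's theorem says that this holds if either $I$ is principal and $A$ has bounded $I$-torsion,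 or $A$ is flat over some noetherian ring $A_0$ having an ideal $I_0$ with $I=I_0A$.) **Theorem.** For none of the following three conditions is it true that the approximation assertion holds for all henselian pairs $(A,I)$ satisfying the condition: * $(E'_a)$ $I$ is principal; * $(E''_a)$ $I$ is finitely generated and $A$ has bounded $I$-torsion, i.e. $I^l\cdot\bigcap_{a\in I}\{x\in A : a^m x=0\text{ for some }m>0\}=0$ for some $l>0$; * $(E'_b)$ there are a ring $A_0$ and an ideal $I_0\subset A_0$ such that the scheme $\operatorname{Spec}A_0\setminus V(I_0)$ is noetherian, $A$ is flat over $A_0$, and $I=I_0A$. Explicitly, let $k$ be any field and $R=k[y,x_0,x_1,\dots]/(x_0y,\ x_i-x_{i+1}y : i\ge 0)$. Put $\mathfrak n=(x_it^{i+2}: i\ge 0)$, an ideal of $R[t]$ or of $R[t,u]$, and $\mathfrak n'=(x_it^iu: i\ge 0)\subset R[t,u]$. 1. The pair consisting of $R[t]/\mathfrak n$ and the ideal generated by $t$ has a henselization $(A,I)$. It satisfies $I=tA$, $(E'_a)$ and $(E'_b)$. The element $\widehat\alpha=\sum_{i\ge 0}x_it^i\in\widehat A$ is a solution of the system $(t-y)X=0$,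 $t^2X=0$. Let $B=A[X]/((t-y)X,\,t^2X)$, let $V=\operatorname{Spec}B\setminus V(IB)$, and let $\overline\varepsilon$ be the section corresponding to $\widehat\alpha$. Then $B,V,\overline\varepsilon$ satisfy the hypotheses of the approximation assertion, but its conclusion fails for $n=1$; indeed no solution of the system in $A$ is congruent to $\widehat\alpha$ modulo $I\widehat A$. 2. The pair consisting of $R[t,u]/(\mathfrak n+\mathfrak n')$ and the ideal generated by $t,u$ has a henselization $(A,I)$. It satisfies $I=(t,u)A$ and $(E''_a)$. The element $\widehat\alpha=\sum_{i\ge 0}x_it^i\in\widehat A$ is a solution of the system $(t-y)X=0$, $t^2X=0$, $uX=0$. Let $B=A[X]/((t-y)X,\,t^2X,\,uX)$, let $V=\operatorname{Spec}B\setminus V(IB)$, and let $\overline\varepsilon$ be the section corresponding to $\widehat\alpha$. Then $B,V,\overline\varepsilon$ satisfy the hypotheses of the approximation assertion, but its conclusion fails for $n=1$; indeed no solution of the system in $A$ is congruent to $\widehat\alpha$ modulo $I\widehat A$. -/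

import Mathlib

open scoped TensorProduct

universe u

noncomputable section

namespace ElkikApprox

/-! ### Henselian pairs and henselization -/

/-- The pair `(A, I)` is henselian: `I` lies in the Jacobson radical of `A`, and every étale
`A`-algebra `A'` for which `A / I → A' ⊗[A] A / I` is an isomorphism admits an
`A`-algebra homomorphism to `A`. -/
def IsHenselianPair {A : Type u} [CommRing A] (I : Ideal A) : Prop :=
  I ≤ Ideal.jacobson ⊥ ∧
  ∀ (A' : Type u) [CommRing A'] [Algebra A A'], Algebra.Etale A A' →
    Function.Bijective
      (Algebra.TensorProduct.includeRight : (A ⧸ I) →ₐ[A] A' ⊗[A] (A ⧸ I)) →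
    Nonempty (A' →ₐ[A] A)

/-- `f : (A, I) → (B, J)` is a morphism of pairs: `f⁻¹(J) = I`. -/
def IsPairHom {A B : Type u} [CommRing A] [CommRing B] (I : Ideal A) (J : Ideal B)
    (f : A →+* B) : Prop :=
  J.comap f = I

/-- `φ : (A₀, I₀) → (A, I)` is the henselization of the pair `(A₀, I₀)`: `(A, I)` is henselian and
`φ` is the universal morphism of pairs from `(A₀, I₀)` to a henselian pair. -/
def IsHenselization {A₀ A : Type u} [CommRing A₀] [CommRing A] (I₀ : Ideal A₀) (I : Ideal A)
    (φ : A₀ →+* A) : Prop :=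
  IsHenselianPair I ∧ IsPairHom I₀ I φ ∧
  ∀ (C : Type u) [CommRing C] (K : Ideal C), IsHenselianPair K →
    ∀ ψ : A₀ →+* C, IsPairHom I₀ K ψ →
      ∃! ψ' : A →+* C, IsPairHom I K ψ' ∧ ψ'.comp φ = ψ

/-! ### The three weakened conditions on a pair -/

/-- The ideal of `a`-torsion elements of `A`: those killed by some power `a ^ n` with `n > 0`. -/
def elementTorsion {A : Type u} [CommRing A] (a : A) : Ideal A where
  carrier := {x | ∃ n : ℕ, 0 < n ∧ a ^ n * x = 0}
  zero_mem' := ⟨1, one_pos, by simp⟩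
  add_mem' := by
    rintro x y ⟨m, hm, hx⟩ ⟨n, -, hy⟩
    refine ⟨m + n, by omega, ?_⟩
    calc a ^ (m + n) * (x + y) = a ^ n * (a ^ m * x) + a ^ m * (a ^ n * y) := by ring
      _ = 0 := by rw [hx, hy]; simp
  smul_mem' := by
    rintro c x ⟨n, hn, hx⟩
    refine ⟨n, hn, ?_⟩
    calc a ^ n * (c • x) = c * (a ^ n * x) := by rw [smul_eq_mul]; ring
      _ = 0 := by rw [hx, mul_zero]

/-- The `I`-torsion ideal of `A`, the intersection of the `a`-torsion ideals for `a ∈ I`. -/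
def idealTorsion {A : Type u} [CommRing A] (I : Ideal A) : Ideal A :=
  ⨅ a ∈ I, elementTorsion a

/-- `A` has bounded `I`-torsion. -/
def HasBoundedTorsion {A : Type u} [CommRing A] (I : Ideal A) : Prop :=
  ∃ l : ℕ, 0 < l ∧ I ^ l * idealTorsion I = ⊥

/-- The open subset `Spec B ∖ V(J)` of `Spec B`. -/
def complV {B : Type u} [CommRing B] (J : Ideal B) :
    TopologicalSpace.Opens (PrimeSpectrum B) :=
  ⟨(PrimeSpectrum.zeroLocus (J : Set B))ᶜ, (PrimeSpectrum.isClosed_zeroLocus _).isOpen_compl⟩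

/-- `A₀` is noetherian outside `I₀`: the open subscheme `Spec A₀ ∖ V(I₀)` is noetherian. -/
def IsNoetherianOutside {A₀ : Type u} [CommRing A₀] (I₀ : Ideal A₀) : Prop :=
  let U : (AlgebraicGeometry.Spec (CommRingCat.of A₀)).Opens := complV I₀
  AlgebraicGeometry.IsNoetherian (U : AlgebraicGeometry.Scheme.{u})

/-- `I` is principal. -/
def CondPrincipal (A : Type u) [CommRing A] (I : Ideal A) : Prop :=
  I.IsPrincipal

/-- `I` is finitely generated and `A` has bounded `I`-torsion. -/
def CondBoundedTorsion (A : Type u) [CommRing A] (I : Ideal A) : Prop :=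
  I.FG ∧ HasBoundedTorsion I

/-- `A` is flat over some `A₀` that is noetherian outside an ideal `I₀` with `I = I₀ A`. -/
def CondNoetherianOutside (A : Type u) [CommRing A] (I : Ideal A) : Prop :=
  ∃ (A₀ : Type u) (_ : CommRing A₀) (_ : Algebra A₀ A) (I₀ : Ideal A₀),
    IsNoetherianOutside I₀ ∧ Module.Flat A₀ A ∧ I = I₀.map (algebraMap A₀ A)

/-! ### Elkik's approximation theorem

A section of `Spec B → Spec A` is an `A`-algebra homomorphism `B → A`, and its restriction to an
open subset of `Spec A` factors through the open subscheme `V` of `Spec B` exactly when it maps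
that open subset into `V`. -/

section Elkik

variable {A : Type u} [CommRing A] (I : Ideal A) {B : Type u} [CommRing B] [Algebra A B]

/-- The preimage in `Spec (Â ⊗[A] B)` of an open subset `V` of `Spec B`. -/
def preimageV (V : TopologicalSpace.Opens (PrimeSpectrum B)) :
    Set (PrimeSpectrum (AdicCompletion I A ⊗[A] B)) :=
  PrimeSpectrum.comap (Algebra.TensorProduct.includeRight :
    B →ₐ[A] AdicCompletion I A ⊗[A] B).toRingHom ⁻¹' V

/-- The data to which Elkik's theorem applies: `B` is a finitely presented `A`-algebra, the open set
`V ⊆ Spec B` is smooth over `Spec A`, and the section `ε'` of `Spec (Â ⊗[A] B)` over `Spec Â`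
sends `Spec Â ∖ V(IÂ)` into the preimage of `V`. -/
def IsElkikDatum (V : TopologicalSpace.Opens (PrimeSpectrum B))
    (ε' : AdicCompletion I A ⊗[A] B →ₐ[AdicCompletion I A] AdicCompletion I A) : Prop :=
  Algebra.FinitePresentation A B ∧
  (V : Set (PrimeSpectrum B)) ⊆ Algebra.smoothLocus A B ∧
  ∀ q ∈ complV (I.map (algebraMap A (AdicCompletion I A))),
    PrimeSpectrum.comap ε'.toRingHom q ∈ preimageV I V

/-- There is a section `ε` of `Spec B` over `Spec A` congruent to `ε'` modulo `I ^ n` and sending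
`Spec A ∖ V(I)` into `V`. -/
def IsApproximable (V : TopologicalSpace.Opens (PrimeSpectrum B))
    (ε' : AdicCompletion I A ⊗[A] B →ₐ[AdicCompletion I A] AdicCompletion I A) (n : ℕ) : Prop :=
  ∃ ε : B →ₐ[A] A,
    (∀ b : B, algebraMap A (AdicCompletion I A) (ε b) - ε' (1 ⊗ₜ[A] b) ∈
      (I ^ n).map (algebraMap A (AdicCompletion I A))) ∧
    ∀ p ∈ complV I, PrimeSpectrum.comap ε.toRingHom p ∈ V

end Elkik

/-- The assertion of Elkik's approximation theorem for all henselian pairs `(A, I)` that satisfy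
the condition `P`. -/
def ElkikTheoremUnder (P : ∀ (A : Type u) [CommRing A], Ideal A → Prop) : Prop :=
  ∀ (A : Type u) [CommRing A] (I : Ideal A), IsHenselianPair I → P A I →
    ∀ (B : Type u) [CommRing B] [Algebra A B] (V : TopologicalSpace.Opens (PrimeSpectrum B))
      (ε' : AdicCompletion I A ⊗[A] B →ₐ[AdicCompletion I A] AdicCompletion I A),
      IsElkikDatum I V ε' → ∀ n : ℕ, IsApproximable I V ε' n

/-! ### The failure of approximation for a homogeneous linear system in one unknown -/

section System

variable {A : Type u} [CommRing A]

/-- `A[X] / (a X : a ∈ S)`. -/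
abbrev SystemAlgebra (S : Set A) : Type u :=
  Polynomial A ⧸ Ideal.span ((fun a : A => Polynomial.C a * Polynomial.X) '' S)

/-- The class of `X` in `A[X] / (a X : a ∈ S)`. -/
def SystemAlgebra.gen (S : Set A) : SystemAlgebra S :=
  Ideal.Quotient.mk _ Polynomial.X

/-- `α = ∑ aᵢ` in the `I`-adic completion of `A`, for a sequence with `aᵢ ∈ I ^ i`. -/
def IsAdicSum (I : Ideal A) (a : ℕ → A) (α : AdicCompletion I A) : Prop :=
  (∀ i, a i ∈ I ^ i) ∧
  ∀ n, AdicCompletion.evalₐ I n α = Ideal.Quotient.mk (I ^ n) (∑ i ∈ Finset.range n, a i)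

/-- `α` is a solution in `Â` of the system `a X = 0` (`a ∈ S`), the corresponding section,
together with `B = A[X] / (a X : a ∈ S)` and `V = Spec B ∖ V(IB)`, is a datum as in Elkik's theorem
for which the conclusion fails modulo `I`, and no solution in `A` is congruent to `α` modulo
`IÂ`. -/
def SystemRefutes (I : Ideal A) (S : Set A) (α : AdicCompletion I A) : Prop :=
  (∀ a ∈ S, algebraMap A (AdicCompletion I A) a * α = 0) ∧
  (∃ ε' : AdicCompletion I A ⊗[A] SystemAlgebra S →ₐ[AdicCompletion I A] AdicCompletion I A,
    ε' (1 ⊗ₜ[A] SystemAlgebra.gen S) = α ∧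
    IsElkikDatum I (complV (I.map (algebraMap A (SystemAlgebra S)))) ε' ∧
    ¬ IsApproximable I (complV (I.map (algebraMap A (SystemAlgebra S)))) ε' 1) ∧
  ¬ ∃ β : A, (∀ a ∈ S, a * β = 0) ∧
    algebraMap A (AdicCompletion I A) β - α ∈ I.map (algebraMap A (AdicCompletion I A))

end System

/-! ### The explicit rings -/

section Rings

variable (k : Type u) [Field k]

/-- The ideal `(x₀ y, xᵢ - xᵢ₊₁ y : i ≥ 0)` of `k[y, x₀, x₁, …]`; the variable `none` is `y` and
`some i` is `xᵢ`. -/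
def idealA : Ideal (MvPolynomial (Option ℕ) k) :=
  Ideal.span ({MvPolynomial.X (some 0) * MvPolynomial.X none} ∪
    Set.range fun i : ℕ =>
      MvPolynomial.X (some i) - MvPolynomial.X (some (i + 1)) * MvPolynomial.X none)

/-- `R = k[y, x₀, x₁, …] / (x₀ y, xᵢ - xᵢ₊₁ y)`. -/
def RingR : Type u := MvPolynomial (Option ℕ) k ⧸ idealA k

instance : CommRing (RingR k) := inferInstanceAs (CommRing (MvPolynomial (Option ℕ) k ⧸ idealA k))

/-- The quotient map `k[y, x₀, x₁, …] → R`. -/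
def toRingR : MvPolynomial (Option ℕ) k →+* RingR k := Ideal.Quotient.mk (idealA k)

/-- The class of `y` in `R`. -/
def yR : RingR k := toRingR k (MvPolynomial.X none)

/-- The class of `xᵢ` in `R`. -/
def xR (i : ℕ) : RingR k := toRingR k (MvPolynomial.X (some i))

/-- The ideal `𝔫 = (x₀ t², x₁ t³, x₂ t⁴, …)` of `R[t]`. -/
def idealN : Ideal (Polynomial (RingR k)) :=
  Ideal.span (Set.range fun i : ℕ => Polynomial.C (xR k i) * Polynomial.X ^ (i + 2))

/-- `A₀ = R[t] / 𝔫`. -/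
abbrev RingA₀ : Type u := Polynomial (RingR k) ⧸ idealN k

/-- The class of `t` in `A₀`. -/
def tA₀ : RingA₀ k := Ideal.Quotient.mk _ Polynomial.X

/-- The class of `y` in `A₀`. -/
def yA₀ : RingA₀ k := Ideal.Quotient.mk _ (Polynomial.C (yR k))

/-- The class of `xᵢ` in `A₀`. -/
def xA₀ (i : ℕ) : RingA₀ k := Ideal.Quotient.mk _ (Polynomial.C (xR k i))

/-- The ideal `𝔫 = (x₀ t², x₁ t³, x₂ t⁴, …)` of `R[t, u]`; the variable `0` is `t` and the
variable `1` is `u`. -/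
def idealN₂ : Ideal (MvPolynomial (Fin 2) (RingR k)) :=
  Ideal.span (Set.range fun i : ℕ => MvPolynomial.C (xR k i) * MvPolynomial.X 0 ^ (i + 2))

/-- The ideal `𝔫' = (x₀ u, x₁ t u, x₂ t² u, …)` of `R[t, u]`. -/
def idealN' : Ideal (MvPolynomial (Fin 2) (RingR k)) :=
  Ideal.span (Set.range fun i : ℕ =>
    MvPolynomial.C (xR k i) * MvPolynomial.X 0 ^ i * MvPolynomial.X 1)

/-- `A₀' = R[t, u] / (𝔫 + 𝔫')`. -/
abbrev RingA₀' : Type u := MvPolynomial (Fin 2) (RingR k) ⧸ (idealN₂ k + idealN' k)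

/-- The class of `t` in `A₀'`. -/
def tA₀' : RingA₀' k := Ideal.Quotient.mk _ (MvPolynomial.X 0)

/-- The class of `u` in `A₀'`. -/
def uA₀' : RingA₀' k := Ideal.Quotient.mk _ (MvPolynomial.X 1)

/-- The class of `y` in `A₀'`. -/
def yA₀' : RingA₀' k := Ideal.Quotient.mk _ (MvPolynomial.C (yR k))

/-- The class of `xᵢ` in `A₀'`. -/
def xA₀' (i : ℕ) : RingA₀' k := Ideal.Quotient.mk _ (MvPolynomial.C (xR k i))

end Rings

end ElkikApprox

end

namespace ElkikApprox

noncomputable section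

/-! ### Étale neighbourhoods of pairs -/

/-! The formal series `∑ xᵢ tⁱ` behaves like a geometric series for `1 / (t - y)`: the relations `x₀
y = 0` and `xᵢ₊₁ y = xᵢ` make the product with `t - y` telescope to zero, and `xᵢ t^(i+2) = 0` makes
`t²` kill it. It solves the system in the completion, while a solution in the henselization would
have to come from a polynomial, which is too short to telescope.

To see this, let `T = (xᵢ tⁱ)`. Comparing coefficients shows that `T` contains the annihilator of
`t²` in the first ring and of every power of `u` in the second, and `T` is killed by `I₀²`. The
henselization `A` is flat over `A₀`, so a solution `β` lies in `T A`
(`IsHenselization.mem_map_of_mul_eq_zero`). Since `A = A₀ + I` and `I₀² T = 0`, the ideal `T A` is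
the image of `T`, so `β` comes from some `b` in `A₀` (`exists_eq_of_mem_map`). As `I ^ n` contracts
into `I₀ ^ n` (`comap_pow`), `(t - y) b` lies in every `I₀ ^ n`. If `b ≡ x₀` modulo `I₀`, the
coefficients of a representative satisfy `yʲ bⱼ = x₀` for all `j`; for large `j` this gives `x₀ = 0`
(`not_approximate_solution`), contrary to `xR_zero_ne_zero`. The second ring reduces to the first
modulo `u`.

The data are admissible because away from `V(I)` the only solution is `X = 0`, so `B` is there
locally isomorphic to `A`. For the noetherian condition, inverting `t` kills all `xᵢ`, leaving a
quotient of a localized polynomial ring in `t, y`. In the second ring, `T A` contains the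
`I`-torsion and is killed by `I²`.

Existence and flatness of the henselization are obtained by realizing it as the filtered colimit of
étale neighbourhoods. -/

/-- `E` is an étale neighbourhood of the pair `(A, I)`: it is étale over `A` and
`A ⧸ I → E ⧸ I E` is an isomorphism. -/
structure IsEtaleNbhd {A : Type u} [CommRing A] (I : Ideal A) (E : Type u) [CommRing E]
    [Algebra A E] : Prop where
  etale : Algebra.Etale A E
  -- A retraction to `A ⧸ I` gives injectivity and the next field surjectivity of `A ⧸ I → E ⧸ I E`.
  -- In this form the condition passes easily through compositions and base changes.
  exists_residue : Nonempty (E →ₐ[A] A ⧸ I)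
  exists_sub_mem : ∀ e : E, ∃ a : A, e - algebraMap A E a ∈ I.map (algebraMap A E)

section EtaleNbhd

variable {A : Type u} [CommRing A] {I : Ideal A} {E : Type u} [CommRing E] [Algebra A E]

theorem IsEtaleNbhd.of_bijective [Algebra.Etale A E]
    (h : Function.Bijective
      (Algebra.TensorProduct.includeRight : (A ⧸ I) →ₐ[A] E ⊗[A] (A ⧸ I))) :
    IsEtaleNbhd I E where
  etale := inferInstance
  exists_residue := ⟨((AlgEquiv.ofBijective _ h).symm : _ →ₐ[A] _).comp
    (Algebra.TensorProduct.includeLeft : E →ₐ[A] E ⊗[A] (A ⧸ I))⟩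
  exists_sub_mem e := by
    obtain ⟨a, ha⟩ := h.2 (e ⊗ₜ 1)
    obtain ⟨a, rfl⟩ := Ideal.Quotient.mk_surjective a
    refine ⟨a, ?_⟩
    rw [← Ideal.Quotient.eq_zero_iff_mem,
      ← EmbeddingLike.map_eq_zero_iff (f := Algebra.TensorProduct.quotIdealMapEquivTensorQuot E I),
      Algebra.TensorProduct.quotIdealMapEquivTensorQuot_mk, TensorProduct.sub_tmul, ← ha,
      Algebra.TensorProduct.includeRight_apply, sub_eq_zero, ← Ideal.Quotient.algebraMap_eq,
      ← Algebra.TensorProduct.algebraMap_apply', Algebra.TensorProduct.algebraMap_apply]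

theorem IsEtaleNbhd.bijective (h : IsEtaleNbhd I E) :
    Function.Bijective
      (Algebra.TensorProduct.includeRight : (A ⧸ I) →ₐ[A] E ⊗[A] (A ⧸ I)) := by
  obtain ⟨p⟩ := h.exists_residue
  constructor
  · refine Function.LeftInverse.injective (g := Algebra.TensorProduct.lift p (AlgHom.id A (A ⧸ I))
      (fun _ _ => Commute.all _ _)) fun x => by simp
  · intro z
    obtain ⟨z, rfl⟩ := (Algebra.TensorProduct.quotIdealMapEquivTensorQuot E I).surjective z
    obtain ⟨e, rfl⟩ := Ideal.Quotient.mk_surjective z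
    obtain ⟨a, ha⟩ := h.exists_sub_mem e
    refine ⟨Ideal.Quotient.mk I a, ?_⟩
    rw [← Ideal.Quotient.eq_zero_iff_mem, map_sub, sub_eq_zero] at ha
    rw [ha, Algebra.TensorProduct.quotIdealMapEquivTensorQuot_mk,
      Algebra.TensorProduct.includeRight_apply, ← Ideal.Quotient.algebraMap_eq,
      ← Algebra.TensorProduct.algebraMap_apply', Algebra.TensorProduct.algebraMap_apply]

theorem IsEtaleNbhd.of_equiv {E' : Type u} [CommRing E'] [Algebra A E'] (h : IsEtaleNbhd I E)
    (e : E ≃ₐ[A] E') : IsEtaleNbhd I E' where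
  etale := have := h.etale; Algebra.Etale.of_equiv e
  exists_residue := h.exists_residue.map fun p => p.comp (e.symm : E' →ₐ[A] E)
  exists_sub_mem x := by
    obtain ⟨a, ha⟩ := h.exists_sub_mem (e.symm x)
    refine ⟨a, ?_⟩
    have := Ideal.mem_map_of_mem (e : E →+* E') ha
    rw [Ideal.map_map] at this
    have he : ((e : E →+* E').comp (algebraMap A E)) = algebraMap A E' := by
      ext; simp
    simpa [he] using this

theorem IsEtaleNbhd.refl (I : Ideal A) : IsEtaleNbhd I A where
  etale := inferInstance
  exists_residue := ⟨Ideal.Quotient.mkₐ A I⟩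
  exists_sub_mem x := ⟨x, by simp⟩

theorem IsEtaleNbhd.residue_apply_eq_zero_iff (h : IsEtaleNbhd I E) (p : E →ₐ[A] A ⧸ I) {e : E} :
    p e = 0 ↔ e ∈ I.map (algebraMap A E) := by
  have hp : ∀ x ∈ I.map (algebraMap A E), p x = 0 := by
    intro x hx
    refine (Ideal.map_le_iff_le_comap (K := RingHom.ker p)).2 (fun i hi => ?_) hx
    rw [Ideal.mem_comap, RingHom.mem_ker, p.commutes, Ideal.Quotient.algebraMap_eq,
      Ideal.Quotient.eq_zero_iff_mem]
    exact hi
  refine ⟨fun he => ?_, hp e⟩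
  obtain ⟨a, ha⟩ := h.exists_sub_mem e
  have h1 := hp _ ha
  rw [map_sub, he, zero_sub, neg_eq_zero, p.commutes, Ideal.Quotient.algebraMap_eq,
    Ideal.Quotient.eq_zero_iff_mem] at h1
  simpa using add_mem ha (Ideal.mem_map_of_mem _ h1)

theorem IsEtaleNbhd.trans {E' : Type u} [CommRing E'] [Algebra A E'] [Algebra E E']
    [IsScalarTower A E E'] (h : IsEtaleNbhd I E)
    (h' : IsEtaleNbhd (I.map (algebraMap A E)) E') : IsEtaleNbhd I E' where
  etale := have := h.etale; have := h'.etale; Algebra.Etale.comp A E E'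
  exists_residue := by
    obtain ⟨p⟩ := h.exists_residue
    obtain ⟨p'⟩ := h'.exists_residue
    refine ⟨(Ideal.Quotient.liftₐ (I.map (algebraMap A E)) p fun a ha =>
      (h.residue_apply_eq_zero_iff p).2 ha).comp (p'.restrictScalars A)⟩
  exists_sub_mem x := by
    obtain ⟨e, he⟩ := h'.exists_sub_mem x
    obtain ⟨a, ha⟩ := h.exists_sub_mem e
    refine ⟨a, ?_⟩
    rw [Ideal.map_map, ← IsScalarTower.algebraMap_eq] at he
    have := Ideal.mem_map_of_mem (algebraMap E E') ha
    rw [Ideal.map_map, ← IsScalarTower.algebraMap_eq, map_sub,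
      ← IsScalarTower.algebraMap_apply] at this
    simpa using add_mem he this

theorem IsEtaleNbhd.baseChange (h : IsEtaleNbhd I E) {C : Type u} [CommRing C] [Algebra A C]
    {K : Ideal C} (hK : I ≤ K.comap (algebraMap A C)) : IsEtaleNbhd K (C ⊗[A] E) where
  etale := have := h.etale; inferInstance
  exists_residue := by
    obtain ⟨p⟩ := h.exists_residue
    let q : (A ⧸ I) →ₐ[A] C ⧸ K := Ideal.Quotient.liftₐ I (Algebra.ofId A (C ⧸ K)) fun a ha => by
      rw [Algebra.ofId_apply, IsScalarTower.algebraMap_apply A C (C ⧸ K),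
        Ideal.Quotient.algebraMap_eq, Ideal.Quotient.eq_zero_iff_mem]
      exact hK ha
    exact ⟨Algebra.TensorProduct.lift (Ideal.Quotient.mkₐ C K) (q.comp p)
      fun _ _ => Commute.all _ _⟩
  exists_sub_mem z := by
    induction z with
    | zero => exact ⟨0, by simp⟩
    | add x y hx hy =>
      obtain ⟨a, ha⟩ := hx
      obtain ⟨b, hb⟩ := hy
      refine ⟨a + b, ?_⟩
      convert add_mem ha hb using 1
      rw [map_add]; ring
    | tmul c e =>
      obtain ⟨a, ha⟩ := h.exists_sub_mem e
      refine ⟨c * algebraMap A C a, ?_⟩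
      have h1 : (Algebra.TensorProduct.includeRight : E →ₐ[A] C ⊗[A] E) (e - algebraMap A E a) ∈
          K.map (algebraMap C (C ⊗[A] E)) := by
        have h2 := Ideal.mem_map_of_mem
          ((Algebra.TensorProduct.includeRight : E →ₐ[A] C ⊗[A] E) : E →+* C ⊗[A] E) ha
        rw [Ideal.map_map, AlgHom.comp_algebraMap, IsScalarTower.algebraMap_eq A C (C ⊗[A] E),
          ← Ideal.map_map] at h2
        exact Ideal.map_mono (Ideal.map_le_iff_le_comap.2 hK) h2
      convert Ideal.mul_mem_left _ (c ⊗ₜ 1) h1 using 1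
      rw [map_sub, AlgHom.commutes, mul_sub, IsScalarTower.algebraMap_apply A C (C ⊗[A] E),
        Algebra.TensorProduct.algebraMap_apply, Algebra.TensorProduct.algebraMap_apply]
      simp

theorem IsEtaleNbhd.tensorProduct (h : IsEtaleNbhd I E) {E' : Type u} [CommRing E']
    [Algebra A E'] (h' : IsEtaleNbhd I E') : IsEtaleNbhd I (E ⊗[A] E') :=
  h.trans (h'.baseChange Ideal.le_comap_map)

theorem IsEtaleNbhd.away (f : A) (hf : 1 - f ∈ I) : IsEtaleNbhd I (Localization.Away f) where
  etale := Algebra.Etale.of_isLocalizationAway f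
  exists_residue := by
    have hu : algebraMap A (A ⧸ I) f = 1 := by
      rw [Ideal.Quotient.algebraMap_eq, eq_comm, ← sub_eq_zero, ← map_one (Ideal.Quotient.mk I),
        ← map_sub, Ideal.Quotient.eq_zero_iff_mem]
      exact hf
    exact ⟨⟨IsLocalization.Away.lift f (g := algebraMap A (A ⧸ I)) (hu ▸ isUnit_one),
      fun a => IsLocalization.Away.lift_eq f _ a⟩⟩
  exists_sub_mem x := by
    obtain ⟨n, a, ha⟩ := IsLocalization.Away.surj f x
    refine ⟨a, ?_⟩
    have h1 : (1 - f ^ n) ∈ I := by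
      rw [← one_pow n]
      exact I.mem_of_dvd (sub_dvd_pow_sub_pow 1 f n) hf
    have h2 := Ideal.mul_mem_left _ x (Ideal.mem_map_of_mem (algebraMap A (Localization.Away f)) h1)
    rw [map_sub, map_one, map_pow, mul_sub, mul_one] at h2
    rwa [← ha]

/-- Two homomorphisms from an étale neighbourhood of `(A, I)` agree near `V(K)`. -/
theorem IsEtaleNbhd.exists_mul_sub_eq_zero (h : IsEtaleNbhd I E) {C : Type u} [CommRing C]
    [Algebra A C] {K : Ideal C} (hK : I ≤ K.comap (algebraMap A C)) (f g : E →ₐ[A] C) :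
    ∃ c : C, 1 - c ∈ K ∧ ∀ s, (f s - g s) * c = 0 := by
  have := h.etale
  -- The separability element of the unramified algebra `E`: it has product `1` and annihilates
  -- every `1 ⊗ s - s ⊗ 1`. Its image under `f ⊗ g` is the required `c`; it is `1` modulo `K`
  -- because `f` and `g` agree there.
  obtain ⟨t, ht, ht1⟩ := Algebra.FormallyUnramified.iff_exists_tensorProduct.1
    (inferInstance : Algebra.FormallyUnramified A E)
  let l : E ⊗[A] E →ₐ[A] C := Algebra.TensorProduct.lift f g fun _ _ => Commute.all _ _
  have hfg : ∀ s, Ideal.Quotient.mk K (f s) = Ideal.Quotient.mk K (g s) := by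
    have hmap : ∀ f : E →ₐ[A] C, ∀ x ∈ I.map (algebraMap A E), f x ∈ K := by
      intro f x hx
      have := Ideal.mem_map_of_mem (f : E →+* C) hx
      rw [Ideal.map_map, AlgHom.comp_algebraMap] at this
      exact Ideal.map_le_iff_le_comap.2 hK this
    intro s
    obtain ⟨a, ha⟩ := h.exists_sub_mem s
    have h1 := hmap f _ ha
    have h2 := hmap g _ ha
    rw [Ideal.Quotient.eq]
    convert sub_mem h1 h2 using 1
    simp
  have hl : ∀ z, Ideal.Quotient.mk K (l z) =
      Ideal.Quotient.mk K (f (Algebra.TensorProduct.lmul' A z)) := by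
    intro z
    induction z with
    | zero => simp
    | add x y hx hy => simp only [map_add, hx, hy]
    | tmul x y => simp [l, hfg y]
  refine ⟨l t, ?_, fun s => ?_⟩
  · rw [← Ideal.Quotient.eq, hl, ht1, map_one, map_one, map_one]
  · have := congrArg l (ht s)
    rw [map_mul, map_sub, map_zero] at this
    simp only [l, Algebra.TensorProduct.lift_tmul, map_one, one_mul, mul_one] at this
    rw [← neg_sub, neg_mul, neg_eq_zero]
    exact this

/-- An element congruent to `1` modulo an ideal in the Jacobson radical is a unit, so agreement near
`V(K)` is agreement. With `K = ⊥` this applies to any target in which `I` becomes zero. -/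
theorem IsEtaleNbhd.algHom_ext (h : IsEtaleNbhd I E) {C : Type u} [CommRing C]
    [Algebra A C] {K : Ideal C} (hK : I ≤ K.comap (algebraMap A C)) (hJ : K ≤ Ideal.jacobson ⊥)
    (f g : E →ₐ[A] C) : f = g := by
  obtain ⟨c, hc, hfg⟩ := h.exists_mul_sub_eq_zero hK f g
  have hu : IsUnit c := by
    have := Ideal.mem_jacobson_bot.1 (hJ hc) (-1)
    simpa using this
  ext s
  exact sub_eq_zero.1 (hu.mul_left_eq_zero.1 (hfg s))

theorem IsEtaleNbhd.exists_algHom (h : IsEtaleNbhd I E) {C : Type u} [CommRing C]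
    [Algebra A C] {K : Ideal C} (hK : I ≤ K.comap (algebraMap A C)) (hC : IsHenselianPair K) :
    Nonempty (E →ₐ[A] C) := by
  have h' := h.baseChange hK
  obtain ⟨s⟩ := hC.2 (C ⊗[A] E) h'.etale h'.bijective
  exact ⟨(s.restrictScalars A).comp Algebra.TensorProduct.includeRight⟩

/-- A pair is henselian if its étale neighbourhoods have sections. -/
theorem isHenselianPair_of_forall_nbhd
    (h : ∀ (E : Type u) [CommRing E] [Algebra A E], IsEtaleNbhd I E → Nonempty (E →ₐ[A] A)) :
    IsHenselianPair I := by
  refine ⟨fun x hx => Ideal.mem_jacobson_bot.2 fun y => ?_, fun E _ _ _ hE => h E (.of_bijective hE)⟩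
  -- A section of the localization at `x * y + 1` forces that element to be a unit, which gives the
  -- Jacobson radical condition.
  obtain ⟨f⟩ := h _ (IsEtaleNbhd.away (I := I) (x * y + 1) (by
    simpa using I.mul_mem_right y hx))
  have := (IsLocalization.Away.algebraMap_isUnit (S := Localization.Away (x * y + 1))
    (x * y + 1)).map f
  simpa using this

/-- Infinitesimal lifting for étale algebras lifts the residue map to a section. -/
theorem isHenselianPair_of_isNilpotent (hI : IsNilpotent I) : IsHenselianPair I := by
  refine isHenselianPair_of_forall_nbhd fun E _ _ hE => ?_
  have := hE.etale
  obtain ⟨p⟩ := hE.exists_residue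
  exact ⟨Algebra.FormallySmooth.lift I hI p⟩

end EtaleNbhd

/-! ### The filtered category of étale neighbourhoods and its colimit -/

/-- A small category of étale neighbourhoods of `(A, I)`: those of the form
`A[X₁, …, Xₙ] / K`. -/
structure EtaleNbhd {A : Type u} [CommRing A] (I : Ideal A) : Type u where
  vars : ℕ
  ker : Ideal (MvPolynomial (Fin vars) A)
  isEtaleNbhd : IsEtaleNbhd I (MvPolynomial (Fin vars) A ⧸ ker)

namespace EtaleNbhd

open CategoryTheory Limits

variable {A : Type u} [CommRing A] {I : Ideal A}

/-- The `A`-algebra underlying an étale neighbourhood. -/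
def Carrier (j : EtaleNbhd I) : Type u := MvPolynomial (Fin j.vars) A ⧸ j.ker

instance (j : EtaleNbhd I) : CommRing j.Carrier :=
  inferInstanceAs (CommRing (MvPolynomial (Fin j.vars) A ⧸ j.ker))

instance (j : EtaleNbhd I) : Algebra A j.Carrier :=
  inferInstanceAs (Algebra A (MvPolynomial (Fin j.vars) A ⧸ j.ker))

theorem isEtaleNbhd_carrier (j : EtaleNbhd I) : IsEtaleNbhd I j.Carrier := j.isEtaleNbhd

theorem exists_algEquiv {E : Type u} [CommRing E] [Algebra A E] (h : IsEtaleNbhd I E) :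
    ∃ j : EtaleNbhd I, Nonempty (E ≃ₐ[A] j.Carrier) := by
  have := h.etale
  obtain ⟨n, f, hf⟩ := Algebra.FiniteType.iff_quotient_mvPolynomial''.1
    (inferInstance : Algebra.FiniteType A E)
  let e := (Ideal.quotientKerAlgEquivOfSurjective hf).symm
  exact ⟨⟨n, RingHom.ker f, h.of_equiv e⟩, ⟨e⟩⟩

instance : SmallCategory (EtaleNbhd I) where
  Hom i j := i.Carrier →ₐ[A] j.Carrier
  id i := AlgHom.id A i.Carrier
  comp f g := AlgHom.comp g f

/-- The morphism of étale neighbourhoods given by a homomorphism of algebras. -/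
def homMk {i j : EtaleNbhd I} (f : i.Carrier →ₐ[A] j.Carrier) : i ⟶ j := f

/-- The homomorphism of algebras underlying a morphism of étale neighbourhoods. -/
def toAlgHom {i j : EtaleNbhd I} (f : i ⟶ j) : i.Carrier →ₐ[A] j.Carrier := f

instance : IsFiltered (EtaleNbhd I) where
  nonempty := ⟨(exists_algEquiv (IsEtaleNbhd.refl I)).choose⟩
  cocone_objs i j := by
    obtain ⟨k, ⟨e⟩⟩ := exists_algEquiv (i.isEtaleNbhd_carrier.tensorProduct j.isEtaleNbhd_carrier)
    exact ⟨k, homMk (e.toAlgHom.comp Algebra.TensorProduct.includeLeft),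
      homMk (e.toAlgHom.comp Algebra.TensorProduct.includeRight), trivial⟩
  cocone_maps i j f g := by
    -- Parallel morphisms become equal once `c` is inverted, and since `c` is `1` modulo the ideal,
    -- this localization is again an étale neighbourhood.
    obtain ⟨c, hc, hfg⟩ := i.isEtaleNbhd_carrier.exists_mul_sub_eq_zero (C := j.Carrier)
      (K := I.map (algebraMap A j.Carrier)) Ideal.le_comap_map (toAlgHom f) (toAlgHom g)
    obtain ⟨k, ⟨e⟩⟩ := exists_algEquiv (j.isEtaleNbhd_carrier.trans (IsEtaleNbhd.away c hc))
    refine ⟨k, homMk (e.toAlgHom.comp (IsScalarTower.toAlgHom A j.Carrier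
      (Localization.Away c))), ?_⟩
    refine AlgHom.ext fun s => ?_
    change e (algebraMap _ _ (toAlgHom f s)) = e (algebraMap _ _ (toAlgHom g s))
    congr 1
    rw [← sub_eq_zero, ← map_sub]
    have := congrArg (algebraMap j.Carrier (Localization.Away c)) (hfg s)
    rw [map_mul, map_zero] at this
    exact (IsLocalization.Away.algebraMap_isUnit c).mul_left_eq_zero.1 this

variable (I) in
/-- The forgetful functor from étale neighbourhoods to rings. -/
def toCommRingCat : EtaleNbhd I ⥤ CommRingCat.{u} where
  obj j := CommRingCat.of j.Carrier
  map f := CommRingCat.ofHom (toAlgHom f).toRingHom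

variable (I) in
/-- The constant diagram `A` maps to the diagram of étale neighbourhoods. -/
def constToCommRingCat :
    (Functor.const (EtaleNbhd I)).obj (CommRingCat.of A) ⟶ toCommRingCat I where
  app j := CommRingCat.ofHom (algebraMap A j.Carrier)
  naturality i j f := by
    ext a
    exact ((toAlgHom f).commutes a).symm

end EtaleNbhd

/-! ### The colimit ring: maps out of it and factorization of maps into it. -/

open EtaleNbhd CategoryTheory Limits

variable {A : Type u} [CommRing A] (I : Ideal A)

/-- The colimit of the étale neighbourhoods of `(A, I)`. -/
def Henselization : Type u := (colimit (toCommRingCat I) : CommRingCat.{u})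

namespace Henselization

instance : CommRing (Henselization I) :=
  inferInstanceAs (CommRing (colimit (toCommRingCat I) : CommRingCat.{u}))

variable {I}

/-- The structure map from an étale neighbourhood to the colimit. -/
def ιRingHom (j : EtaleNbhd I) : j.Carrier →+* Henselization I :=
  (colimit.ι (toCommRingCat I) j).hom

theorem ιRingHom_comp {i j : EtaleNbhd I} (f : i ⟶ j) :
    (ιRingHom j).comp (toAlgHom f).toRingHom = ιRingHom i :=
  congrArg CommRingCat.Hom.hom (colimit.w (toCommRingCat I) f)

instance : Algebra A (Henselization I) :=
  ((ιRingHom (exists_algEquiv (IsEtaleNbhd.refl I)).choose).comp (algebraMap A _)).toAlgebra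

theorem ιRingHom_comp_algebraMap (j : EtaleNbhd I) :
    (ιRingHom j).comp (algebraMap A j.Carrier) = algebraMap A (Henselization I) := by
  obtain ⟨e⟩ := (exists_algEquiv (IsEtaleNbhd.refl I)).choose_spec
  have h := ιRingHom_comp (homMk ((Algebra.ofId A j.Carrier).comp e.symm.toAlgHom))
  change _ = (ιRingHom (exists_algEquiv (IsEtaleNbhd.refl I)).choose).comp (algebraMap A _)
  rw [← h, RingHom.comp_assoc]
  congr 1
  exact (AlgHom.comp_algebraMap
    ((Algebra.ofId A j.Carrier).comp e.symm.toAlgHom)).symm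

/-- The structure map from an étale neighbourhood to the colimit, as a homomorphism of algebras. -/
def ι (j : EtaleNbhd I) : j.Carrier →ₐ[A] Henselization I :=
  { ιRingHom j with commutes' := fun a => RingHom.congr_fun (ιRingHom_comp_algebraMap j) a }

theorem ι_comp {i j : EtaleNbhd I} (f : i ⟶ j) (x : i.Carrier) : ι j (toAlgHom f x) = ι i x :=
  RingHom.congr_fun (ιRingHom_comp f) x

theorem exists_ι_eq (x : Henselization I) : ∃ (j : EtaleNbhd I) (e : j.Carrier), ι j e = x :=
  Concrete.colimit_exists_rep (toCommRingCat I) x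

theorem hom_ext {C : Type u} [CommRing C] {f g : Henselization I →+* C}
    (h : ∀ j, f.comp (ιRingHom j) = g.comp (ιRingHom j)) : f = g := by
  ext x
  obtain ⟨j, e, rfl⟩ := exists_ι_eq x
  exact RingHom.congr_fun (h j) e

/-- A compatible family of homomorphisms on étale neighbourhoods induces one on the colimit. -/
theorem exists_desc {C : Type u} [CommRing C] [Algebra A C]
    (f : ∀ j : EtaleNbhd I, j.Carrier →ₐ[A] C)
    (hf : ∀ (i j : EtaleNbhd I) (g : i ⟶ j), (f j).comp (toAlgHom g) = f i) :
    ∃ F : Henselization I →ₐ[A] C, ∀ j x, F (ι j x) = f j x := by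
  let c : Cocone (toCommRingCat I) :=
    { pt := CommRingCat.of C
      ι := { app := fun j => CommRingCat.ofHom (f j).toRingHom
             naturality := fun i j g => by
              ext x
              exact AlgHom.congr_fun (hf i j g) x } }
  let F : Henselization I →+* C := (colimit.desc (toCommRingCat I) c).hom
  have hF : ∀ j x, F (ι j x) = f j x := fun j x =>
    ConcreteCategory.congr_hom (colimit.ι_desc c j) x
  refine ⟨{ F with commutes' := fun a => ?_ }, hF⟩
  let j : EtaleNbhd I := (IsFiltered.nonempty (C := EtaleNbhd I)).some
  have := hF j (algebraMap A _ a)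
  rwa [AlgHom.commutes, AlgHom.commutes] at this

/-- A homomorphism from a finitely presented algebra to the colimit of the étale neighbourhoods
factors through one of them. -/
theorem exists_factorization_of_finitePresentation {P : Type u} [CommRing P] [Algebra A P]
    [Algebra.FinitePresentation A P] (g : P →ₐ[A] Henselization I) :
    ∃ (j : EtaleNbhd I) (g' : P →ₐ[A] j.Carrier), (ι j).comp g' = g := by
  obtain ⟨j, g', h1, h2⟩ := RingHom.EssFiniteType.exists_eq_comp_ι_app_of_isColimit
    (CommRingCat.of A) (toCommRingCat I) (constToCommRingCat I)
    (CommRingCat.ofHom (algebraMap A P)) (colimit.cocone (toCommRingCat I)) (colimit.isColimit _)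
    (RingHom.finitePresentation_algebraMap.2 inferInstance)
    (CommRingCat.ofHom g.toRingHom) (fun i => by
      ext a
      exact (g.commutes a).trans ((ι i).commutes a).symm)
  refine ⟨j, { g'.hom with commutes' := fun a => ConcreteCategory.congr_hom h1 a }, ?_⟩
  ext x
  exact (ConcreteCategory.congr_hom h2 x).symm

/-- A homomorphism from a finitely generated ring to the colimit of the étale neighbourhoods
factors through one of them. -/
theorem exists_factorization_of_finiteType {D : Type u} [CommRing D] [Algebra.FiniteType ℤ D]
    (g : D →+* Henselization I) :
    ∃ (j : EtaleNbhd I) (g' : D →+* j.Carrier), (ι j : _ →+* _).comp g' = g := by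
  have hsub : ∀ (C : Type u) [CommRing C], Subsingleton (ULift.{u} ℤ →+* C) := fun C _ =>
    ⟨fun f g => by
      have h : f.comp (ULift.ringEquiv.symm : ℤ ≃+* ULift.{u} ℤ).toRingHom =
        g.comp (ULift.ringEquiv.symm : ℤ ≃+* ULift.{u} ℤ).toRingHom := RingHom.ext_int _ _
      ext ⟨x⟩
      exact RingHom.congr_fun h x⟩
  -- Finite type over the noetherian ring `ℤ` means finite presentation, so maps into a filtered
  -- colimit factor; `ULift` only places `ℤ` in the right universe.
  have hfp : ((algebraMap ℤ D).comp
      (ULift.ringEquiv : ULift.{u} ℤ ≃+* ℤ).toRingHom).FinitePresentation :=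
    .comp (RingHom.finitePresentation_algebraMap.2 (Algebra.FinitePresentation.of_finiteType.1
      inferInstance)) (.of_bijective ULift.ringEquiv.bijective)
  obtain ⟨j, g', h1, h2⟩ := RingHom.EssFiniteType.exists_eq_comp_ι_app_of_isColimit
    (CommRingCat.of (ULift.{u} ℤ)) (toCommRingCat I)
    { app := fun j => CommRingCat.ofHom
        ((Int.castRingHom j.Carrier).comp (ULift.ringEquiv : ULift.{u} ℤ ≃+* ℤ).toRingHom)
      naturality := fun i j f => by
        apply CommRingCat.hom_ext
        exact (hsub _).elim _ _ }
    (CommRingCat.ofHom _) (colimit.cocone (toCommRingCat I)) (colimit.isColimit _) hfp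
    (CommRingCat.ofHom g) (fun i => by
        apply CommRingCat.hom_ext
        exact (hsub _).elim _ _)
  refine ⟨j, g'.hom, ?_⟩
  ext x
  exact (ConcreteCategory.congr_hom h2 x).symm

end Henselization

theorem IsEtaleNbhd.flat {A : Type u} [CommRing A] {I : Ideal A} {E : Type u} [CommRing E]
    [Algebra A E] (h : IsEtaleNbhd I E) : Module.Flat A E :=
  have := h.etale
  inferInstance

theorem isTrivialRelation_map {A M N : Type*} [CommRing A] [AddCommGroup M] [Module A M]
    [AddCommGroup N] [Module A N] (g : M →ₗ[A] N) {l : ℕ} {f : Fin l → A} {x : Fin l → M}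
    (h : Module.IsTrivialRelation f x) : Module.IsTrivialRelation f fun i => g (x i) := by
  obtain ⟨m, a, y, h1, h2⟩ := h
  exact ⟨m, a, fun i => g (y i), fun i => by simp [h1], h2⟩

/-! ### Residue ring, flatness and the henselian property of the colimit. -/

namespace Henselization

open EtaleNbhd

variable {A : Type u} [CommRing A] {I : Ideal A}

variable (I) in
theorem exists_residue : Nonempty (Henselization I →ₐ[A] A ⧸ I) := by
  obtain ⟨F, -⟩ := exists_desc (fun j : EtaleNbhd I => j.isEtaleNbhd_carrier.exists_residue.some)
    fun i _ _ => i.isEtaleNbhd_carrier.algHom_ext (K := ⊥) (fun a ha => by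
      simpa [Ideal.Quotient.eq_zero_iff_mem] using ha) bot_le _ _
  exact ⟨F⟩

theorem exists_sub_mem (x : Henselization I) :
    ∃ a : A, x - algebraMap A _ a ∈ I.map (algebraMap A (Henselization I)) := by
  obtain ⟨j, e, rfl⟩ := exists_ι_eq x
  obtain ⟨a, ha⟩ := j.isEtaleNbhd_carrier.exists_sub_mem e
  refine ⟨a, ?_⟩
  have := Ideal.mem_map_of_mem (ι j : j.Carrier →+* Henselization I) ha
  rw [Ideal.map_map, AlgHom.comp_algebraMap] at this
  simpa using this

variable (I) in
theorem comap_map : (I.map (algebraMap A (Henselization I))).comap (algebraMap A _) = I := by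
  refine le_antisymm (fun a ha => ?_) Ideal.le_comap_map
  obtain ⟨p⟩ := exists_residue I
  have hp : I.map (algebraMap A (Henselization I)) ≤ RingHom.ker p := by
    refine Ideal.map_le_iff_le_comap.2 fun i hi => ?_
    rw [Ideal.mem_comap, RingHom.mem_ker, p.commutes, Ideal.Quotient.algebraMap_eq,
      Ideal.Quotient.eq_zero_iff_mem]
    exact hi
  have := hp ha
  rwa [RingHom.mem_ker, p.commutes, Ideal.Quotient.algebraMap_eq,
      Ideal.Quotient.eq_zero_iff_mem] at this

/-- A linear relation in the colimit holds in some étale neighbourhood. -/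
theorem exists_relation_lift {l : ℕ} {f : Fin l → A} {x : Fin l → Henselization I}
    (hx : ∑ i, f i • x i = 0) :
    ∃ (j : EtaleNbhd I) (x' : Fin l → j.Carrier), (∀ i, ι j (x' i) = x i) ∧
      ∑ i, f i • x' i = 0 := by
  -- The quotient by the linear form `r` represents solutions of the relation and is finitely
  -- presented, so the given solution factors through one étale neighbourhood.
  obtain ⟨r, hr⟩ : ∃ r : MvPolynomial (Fin l) A, ∀ (C : Type u) [CommRing C] [Algebra A C]
      (z : Fin l → C), MvPolynomial.aeval z r = ∑ i, f i • z i :=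
    ⟨∑ i, MvPolynomial.C (f i) * MvPolynomial.X i, fun C _ _ z => by
      simp [Algebra.smul_def]⟩
  have : Algebra.FinitePresentation A (MvPolynomial (Fin l) A ⧸ Ideal.span {r}) :=
    Algebra.FinitePresentation.quotient (Submodule.fg_span_singleton r)
  obtain ⟨g, hgX⟩ : ∃ g : (MvPolynomial (Fin l) A ⧸ Ideal.span {r}) →ₐ[A] Henselization I,
      ∀ i, g (Ideal.Quotient.mk _ (MvPolynomial.X i)) = x i := by
    refine ⟨Ideal.Quotient.liftₐ _ (MvPolynomial.aeval x) fun a ha => ?_, fun i => ?_⟩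
    · obtain ⟨b, rfl⟩ := Ideal.mem_span_singleton'.1 ha
      rw [map_mul, hr, hx, mul_zero]
    · exact MvPolynomial.aeval_X _ _
  obtain ⟨j, g', rfl⟩ := exists_factorization_of_finitePresentation g
  refine ⟨j, fun i => g' (Ideal.Quotient.mk _ (MvPolynomial.X i)), hgX, ?_⟩
  have h : g'.comp (Ideal.Quotient.mkₐ A (Ideal.span {r})) =
      MvPolynomial.aeval fun i => g' (Ideal.Quotient.mk _ (MvPolynomial.X i)) :=
    MvPolynomial.algHom_ext fun i => by simp
  rw [← hr, ← h, AlgHom.comp_apply, Ideal.Quotient.mkₐ_eq_mk,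
    Ideal.Quotient.eq_zero_iff_mem.2 (Ideal.mem_span_singleton_self r), map_zero]

variable (I) in
theorem flat : Module.Flat A (Henselization I) :=
  Module.Flat.of_forall_isTrivialRelation fun {l f x} hx => by
    obtain ⟨j, x', hx', hrel⟩ := exists_relation_lift hx
    rw [← funext hx']
    have := j.isEtaleNbhd_carrier.flat
    exact isTrivialRelation_map (ι j).toLinearMap
      (Module.Flat.isTrivialRelation_of_sum_smul_eq_zero hrel)

section Descent

variable {F D ED : Type u} [CommRing F] [CommRing D] [CommRing ED]
  [Algebra A F] [Algebra F (Henselization I)] [IsScalarTower A F (Henselization I)]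
  [Algebra D F] [Algebra D (Henselization I)] [IsScalarTower D F (Henselization I)] [Algebra D ED]

/-- If an étale algebra over an étale neighbourhood `F` becomes an étale neighbourhood over the
colimit, then it is one over `A`. -/
theorem isEtaleNbhd_of_baseChange [SMulCommClass D A F] [SMulCommClass A D F]
    [Algebra.Etale D ED] (hF : IsEtaleNbhd I F)
    (hE : IsEtaleNbhd (I.map (algebraMap A (Henselization I))) (Henselization I ⊗[D] ED)) :
    IsEtaleNbhd I (F ⊗[D] ED) := by
  obtain ⟨pH⟩ := exists_residue I
  let τ : F ⊗[D] ED →ₐ[D] Henselization I ⊗[D] ED :=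
    Algebra.TensorProduct.map (IsScalarTower.toAlgHom D F (Henselization I)) (AlgHom.id D ED)
  have hpH : ∀ x ∈ I.map (algebraMap A (Henselization I)), pH x = 0 := by
    intro x hx
    refine (Ideal.map_le_iff_le_comap (K := RingHom.ker pH)).2 (fun i hi => ?_) hx
    rw [Ideal.mem_comap, RingHom.mem_ker, pH.commutes, Ideal.Quotient.algebraMap_eq,
      Ideal.Quotient.eq_zero_iff_mem]
    exact hi
  refine ⟨have := hF.etale; Algebra.Etale.comp A F _, ?_, fun x => ?_⟩
  · obtain ⟨pE⟩ := hE.exists_residue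
    let pH' := Ideal.Quotient.lift (I.map (algebraMap A (Henselization I))) (pH : _ →+* A ⧸ I) hpH
    refine ⟨{ (pH'.comp (pE : _ →+* _)).comp τ.toRingHom with commutes' := fun a => ?_ }⟩
    change pH' (pE (τ (algebraMap A F a ⊗ₜ 1))) = _
    have : τ (algebraMap A F a ⊗ₜ 1) = algebraMap (Henselization I) (Henselization I ⊗[D] ED)
        (algebraMap A (Henselization I) a) := by
      simp [τ, Algebra.TensorProduct.algebraMap_apply, ← IsScalarTower.algebraMap_apply]
    rw [this, pE.commutes]
    exact pH.commutes a
  -- A map `ρ` back from the base change over the colimit to `(F ⊗ ED) ⧸ IE` is built through `A ⧸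
  -- I`. It carries surjectivity modulo the ideal back to `F ⊗ ED`.
  · let IE : Ideal (F ⊗[D] ED) := I.map (algebraMap A (F ⊗[D] ED))
    let q : (A ⧸ I) →ₐ[A] ((F ⊗[D] ED) ⧸ IE) := Ideal.Quotient.liftₐ I (Algebra.ofId A _)
      fun a ha => by
        rw [Algebra.ofId_apply, IsScalarTower.algebraMap_apply A (F ⊗[D] ED) ((F ⊗[D] ED) ⧸ IE),
          Ideal.Quotient.algebraMap_eq, Ideal.Quotient.eq_zero_iff_mem]
        exact Ideal.mem_map_of_mem _ ha
    let ρ₁ : Henselization I →ₐ[A] ((F ⊗[D] ED) ⧸ IE) := q.comp pH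
    have hρ₁ : ∀ f : F, ρ₁ (algebraMap F (Henselization I) f) =
        Ideal.Quotient.mk IE (f ⊗ₜ 1) := by
      intro f
      -- In the quotient by `IE` the image of `I` is zero, so the étale neighbourhood `F` has only
      -- one map to it. This makes `ρ` well defined and compatible with `τ`.
      have := hF.algHom_ext (K := ⊥) (fun a ha => by
        rw [Ideal.mem_comap, Ideal.mem_bot,
          IsScalarTower.algebraMap_apply A (F ⊗[D] ED) ((F ⊗[D] ED) ⧸ IE),
          Ideal.Quotient.algebraMap_eq, Ideal.Quotient.eq_zero_iff_mem]
        exact Ideal.mem_map_of_mem _ ha) bot_le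
        (ρ₁.comp (IsScalarTower.toAlgHom A F (Henselization I)))
        ((Ideal.Quotient.mkₐ A IE).comp (Algebra.TensorProduct.includeLeft))
      exact AlgHom.congr_fun this f
    let ρ : Henselization I ⊗[D] ED →ₐ[D] ((F ⊗[D] ED) ⧸ IE) :=
      Algebra.TensorProduct.lift
        { (ρ₁ : _ →+* _) with
          commutes' := fun d => by
            change ρ₁ _ = _
            rw [IsScalarTower.algebraMap_apply D F (Henselization I), hρ₁]
            rfl }
        ((Ideal.Quotient.mkₐ D IE).comp Algebra.TensorProduct.includeRight)
        fun _ _ => Commute.all _ _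
    have hρH : ∀ h, ρ (algebraMap (Henselization I) _ h) = ρ₁ h := fun h => by
      simp only [ρ, Algebra.TensorProduct.algebraMap_apply, Algebra.TensorProduct.lift_tmul,
        map_one, mul_one]
      rfl
    have hρτ : ∀ z, ρ (τ z) = Ideal.Quotient.mk IE z := by
      intro z
      induction z with
      | zero => simp
      | add x y hx hy => simp only [map_add, hx, hy]
      | tmul f e =>
        have : f ⊗ₜ[D] e = (f ⊗ₜ 1) * (1 ⊗ₜ e) := by simp
        rw [this, map_mul (Ideal.Quotient.mk IE), ← hρ₁]
        simp only [mul_one, one_mul, Algebra.TensorProduct.tmul_mul_tmul, τ, ρ,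
          Algebra.TensorProduct.map_tmul, Algebra.TensorProduct.lift_tmul]
        rfl
    obtain ⟨h, hh⟩ := hE.exists_sub_mem (τ x)
    obtain ⟨a, ha⟩ := exists_sub_mem h
    refine ⟨a, ?_⟩
    have hker : ∀ x ∈ I.map (algebraMap A (Henselization I)), ρ₁ x = 0 := fun x hx => by
      simp only [ρ₁, AlgHom.comp_apply, hpH x hx, map_zero]
    have hker' : ρ (τ x - algebraMap _ _ h) = 0 := by
      refine (Ideal.map_le_iff_le_comap (K := RingHom.ker ρ)).2 (fun i hi => ?_) hh
      rw [Ideal.mem_comap, RingHom.mem_ker, hρH]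
      exact hker i hi
    have ha' := hker _ ha
    rw [map_sub, hρτ, hρH, sub_eq_zero] at hker'
    rw [map_sub, sub_eq_zero, AlgHom.commutes] at ha'
    rw [← Ideal.Quotient.eq_zero_iff_mem, map_sub, hker', ha', sub_eq_zero]
    rfl

end Descent

/-- Étale neighbourhoods of the colimit have sections. -/
theorem exists_section {E : Type u} [CommRing E] [Algebra (Henselization I) E]
    (hE : IsEtaleNbhd (I.map (algebraMap A (Henselization I))) E) :
    Nonempty (E →ₐ[Henselization I] Henselization I) := by
  have := hE.etale
  -- The étale algebra is defined over a finitely generated subring `D`, whose inclusion factors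
  -- through some étale neighbourhood `j`. Base change to `j` then gives an étale neighbourhood of
  -- `A`, which maps to the colimit.
  obtain ⟨D, ED, _, _, hD, _, ⟨e⟩⟩ :=
    Algebra.Etale.exists_subalgebra_fg ℤ (Henselization I) E
  have : Algebra.FiniteType ℤ D := (Subalgebra.fg_iff_finiteType D).1 hD
  obtain ⟨j, g, hg⟩ := exists_factorization_of_finiteType (algebraMap D (Henselization I))
  let := g.toAlgebra
  let := (ι j).toRingHom.toAlgebra
  have : IsScalarTower A j.Carrier (Henselization I) :=
    .of_algebraMap_eq fun a => ((ι j).commutes a).symm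
  have : IsScalarTower D j.Carrier (Henselization I) :=
    .of_algebraMap_eq fun d => (RingHom.congr_fun hg d).symm
  have : SMulCommClass D A j.Carrier := ⟨fun d a x => by
    simp only [Algebra.smul_def]; ring⟩
  have : SMulCommClass A D j.Carrier := SMulCommClass.symm _ _ _
  have hdesc : IsEtaleNbhd I (j.Carrier ⊗[D] ED) :=
    isEtaleNbhd_of_baseChange j.isEtaleNbhd_carrier (hE.of_equiv e)
  obtain ⟨k, ⟨f⟩⟩ := exists_algEquiv hdesc
  let s : j.Carrier ⊗[D] ED →ₐ[A] Henselization I := (ι k).comp f.toAlgHom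
  have hs : ∀ x : j.Carrier, s (x ⊗ₜ 1) = ι j x := fun x =>
    ι_comp (homMk (f.toAlgHom.comp Algebra.TensorProduct.includeLeft)) x
  let s' : ED →ₐ[D] Henselization I :=
    { (s : _ →+* _).comp (Algebra.TensorProduct.includeRight :
        ED →ₐ[D] j.Carrier ⊗[D] ED).toRingHom with
      commutes' := fun d => by
        change s (1 ⊗ₜ algebraMap D ED d) = _
        rw [← Algebra.TensorProduct.algebraMap_apply', Algebra.TensorProduct.algebraMap_apply, hs]
        exact RingHom.congr_fun hg d }
  exact ⟨(Algebra.TensorProduct.lift (AlgHom.id (Henselization I) (Henselization I)) s'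
    fun _ _ => Commute.all _ _).comp e.toAlgHom⟩

variable (I) in
/-- The colimit of the étale neighbourhoods is the henselization. -/
theorem isHenselization :
    IsHenselization I (I.map (algebraMap A (Henselization I))) (algebraMap A _) := by
  refine ⟨isHenselianPair_of_forall_nbhd fun E _ _ hE => exists_section hE, comap_map I,
    fun C _ K hK ψ hψ => ?_⟩
  let := ψ.toAlgebra
  have hle : I ≤ K.comap (algebraMap A C) := hψ.ge
  obtain ⟨F, hF⟩ := exists_desc
    (fun j : EtaleNbhd I => (j.isEtaleNbhd_carrier.exists_algHom hle hK).some)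
    fun i _ _ => i.isEtaleNbhd_carrier.algHom_ext hle hK.1 _ _
  refine ⟨F, ⟨le_antisymm (fun x hx => ?_) ?_, F.comp_algebraMap⟩, ?_⟩
  -- Modulo the extended ideal `x` is an element `a` of the base, and for `a` the equality `ψ⁻¹(K) =
  -- I` applies.
  · obtain ⟨a, ha⟩ := exists_sub_mem x
    have h1 : F (x - algebraMap A _ a) ∈ K := by
      refine (Ideal.map_le_iff_le_comap (K := K.comap (F : _ →+* C))).2 (fun i hi => ?_) ha
      rw [Ideal.mem_comap, Ideal.mem_comap]
      simpa using hle hi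
    have h2 : algebraMap A C a ∈ K := by
      rw [map_sub, F.commutes] at h1
      exact (Submodule.sub_mem_iff_right K (show F x ∈ K from hx)).1 h1
    have h3 : a ∈ I := hψ.le h2
    simpa using add_mem ha (Ideal.mem_map_of_mem _ h3)
  · refine Ideal.map_le_iff_le_comap.2 fun i hi => ?_
    rw [Ideal.mem_comap, Ideal.mem_comap]
    simpa using hle hi
  · rintro G ⟨-, hG⟩
    refine hom_ext fun j => ?_
    have := j.isEtaleNbhd_carrier.algHom_ext hle hK.1
      (AlgHom.comp { G with commutes' := RingHom.congr_fun hG } (ι j)) (F.comp (ι j))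
    exact congrArg AlgHom.toRingHom this

end Henselization

/-! ### Properties of an arbitrary henselization -/

namespace IsHenselization

variable {A₀ A : Type u} [CommRing A₀] [CommRing A] {I₀ : Ideal A₀} {I : Ideal A} {φ : A₀ →+* A}

theorem exists_ringEquiv (h : IsHenselization I₀ I φ) {A' : Type u} [CommRing A'] {I' : Ideal A'}
    {φ' : A₀ →+* A'} (h' : IsHenselization I₀ I' φ') :
    ∃ e : A ≃+* A', (e : A →+* A').comp φ = φ' ∧ I'.comap (e : A →+* A') = I := by
  obtain ⟨f, ⟨hf, hfφ⟩, -⟩ := h.2.2 A' I' h'.1 φ' h'.2.1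
  obtain ⟨g, ⟨hg, hgφ⟩, -⟩ := h'.2.2 A I h.1 φ h.2.1
  have hcomp : ∀ {B C : Type u} [CommRing B] [CommRing C] {J : Ideal B} {K : Ideal C}
      {f : B →+* C} {g : C →+* B}, IsPairHom J K f → IsPairHom K J g →
      IsPairHom J J (g.comp f) := fun hf hg => by
    rw [IsPairHom, ← Ideal.comap_comap, hg, hf]
  have hid : ∀ {B : Type u} [CommRing B] (J : Ideal B), IsPairHom J J (RingHom.id B) :=
    fun J => Ideal.comap_id J
  have h1 : g.comp f = RingHom.id A := (h.2.2 A I h.1 φ h.2.1).unique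
    ⟨hcomp hf hg, by rw [RingHom.comp_assoc, hfφ, hgφ]⟩ ⟨hid I, RingHom.id_comp φ⟩
  have h2 : f.comp g = RingHom.id A' := (h'.2.2 A' I' h'.1 φ' h'.2.1).unique
    ⟨hcomp hg hf, by rw [RingHom.comp_assoc, hgφ, hfφ]⟩ ⟨hid I', RingHom.id_comp φ'⟩
  exact ⟨RingEquiv.ofRingHom f g h2 h1, hfφ, hf⟩

theorem eq_map (h : IsHenselization I₀ I φ) : I = I₀.map φ := by
  obtain ⟨e, he, hI⟩ := (Henselization.isHenselization I₀).exists_ringEquiv h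
  rw [← he, ← Ideal.map_map, ← hI]
  exact (Ideal.map_comap_of_surjective _ e.surjective I).symm

theorem flat (h : IsHenselization I₀ I φ) : φ.Flat := by
  obtain ⟨e, he, -⟩ := (Henselization.isHenselization I₀).exists_ringEquiv h
  rw [← he]
  exact RingHom.Flat.comp (RingHom.flat_algebraMap_iff.2 (Henselization.flat I₀))
    (RingHom.Flat.of_bijective e.bijective)

theorem exists_sub_mem (h : IsHenselization I₀ I φ) (a : A) : ∃ b, a - φ b ∈ I := by
  obtain ⟨e, he, hI⟩ := h.exists_ringEquiv (Henselization.isHenselization I₀)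
  obtain ⟨b, hb⟩ := Henselization.exists_sub_mem (e a)
  refine ⟨b, ?_⟩
  rwa [← hI, Ideal.mem_comap, map_sub, ← RingHom.comp_apply, he]

/-- The quotient `A₀ ⧸ I₀ ^ n` is a henselian pair for its nilpotent ideal, so the universal
property extends the quotient map to `A`, and this extension kills `I ^ n`. -/
theorem comap_pow (h : IsHenselization I₀ I φ) (n : ℕ) : (I ^ n).comap φ ≤ I₀ ^ n := by
  -- For `n = 0` the inclusion is trivial; for `n > 0` one has `I₀ ^ n ≤ I₀`, as needed for a
  -- morphism of pairs.
  rcases Nat.eq_zero_or_pos n with rfl | hn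
  · simp
  let ψ := Ideal.Quotient.mk (I₀ ^ n)
  have hK : IsHenselianPair (I₀.map ψ) := isHenselianPair_of_isNilpotent
    ⟨n, by rw [← Ideal.map_pow]; exact Ideal.map_quotient_self _⟩
  have hψ : IsPairHom I₀ (I₀.map ψ) ψ := by
    rw [IsPairHom, Ideal.comap_map_of_surjective _ Ideal.Quotient.mk_surjective,
      ← RingHom.ker_eq_comap_bot, Ideal.mk_ker, sup_eq_left]
    exact Ideal.pow_le_self hn.ne'
  obtain ⟨ψ', ⟨-, hψ'⟩, -⟩ := h.2.2 _ _ hK ψ hψ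
  intro a ha
  rw [Ideal.mem_comap, h.eq_map, ← Ideal.map_pow] at ha
  have := Ideal.mem_map_of_mem ψ' ha
  rw [Ideal.map_map, hψ', ← RingHom.comp_apply, hψ', Ideal.map_quotient_self, Ideal.mem_bot,
    Ideal.Quotient.eq_zero_iff_mem] at this
  exact this

/-- The annihilator of an element of `A₀` generates its annihilator in the henselization. -/
theorem mem_map_of_mul_eq_zero (h : IsHenselization I₀ I φ) {s : A₀} {T : Ideal A₀}
    (hT : ∀ a, s * a = 0 → a ∈ T) {β : A} (hβ : φ s * β = 0) : β ∈ T.map φ := by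
  let := φ.toAlgebra
  have : Module.Flat A₀ A := h.flat
  -- The equational criterion for flatness, applied to a relation with a single term, writes `β` as
  -- a combination of elements annihilating `s` in `A₀`.
  obtain ⟨m, a, y, h1, h2⟩ := Module.Flat.isTrivialRelation_of_sum_smul_eq_zero
    (f := fun _ : Fin 1 => s) (x := fun _ => β) (by simpa [Algebra.smul_def] using! hβ)
  have h10 : β = ∑ j, a 0 j • y j := h1 0
  rw [h10]
  refine Ideal.sum_mem _ fun j _ => ?_
  rw [Algebra.smul_def]
  exact Ideal.mul_mem_right _ _ (Ideal.mem_map_of_mem φ (hT _ (by simpa using h2 j)))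

/-- Since `A = φ(A₀) + I`, the ideal `T A` equals `φ(T) + I₀ T A`. -/
theorem exists_sub_mem_map_mul (h : IsHenselization I₀ I φ) {T : Ideal A₀} {β : A}
    (hβ : β ∈ T.map φ) : ∃ b ∈ T, β - φ b ∈ (I₀ * T).map φ := by
  refine Submodule.span_induction (p := fun β _ => ∃ b ∈ T, β - φ b ∈ (I₀ * T).map φ)
    ?_ ⟨0, zero_mem _, by simp⟩ ?_ ?_ hβ
  · rintro _ ⟨b, hb, rfl⟩
    exact ⟨b, hb, by simp⟩
  · rintro x y - - ⟨b, hb, hx⟩ ⟨c, hc, hy⟩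
    refine ⟨b + c, add_mem hb hc, ?_⟩
    have := add_mem hx hy
    rwa [sub_add_sub_comm, ← map_add] at this
  · rintro a x - ⟨b, hb, hx⟩
    obtain ⟨c, hc⟩ := h.exists_sub_mem a
    refine ⟨c * b, T.mul_mem_left c hb, ?_⟩
    rw [h.eq_map] at hc
    have h1 := Ideal.mul_mem_mul hc (Ideal.mem_map_of_mem φ hb)
    rw [← Ideal.map_mul] at h1
    have := add_mem (Ideal.mul_mem_left _ a hx) h1
    rwa [mul_sub, sub_mul, sub_add_sub_cancel, ← map_mul] at this

/-- Ideals killed by a power of `I₀` do not grow in the henselization. -/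
theorem exists_eq_of_mem_map (h : IsHenselization I₀ I φ) {T : Ideal A₀} {m : ℕ}
    (hT : I₀ ^ m * T = ⊥) {β : A} (hβ : β ∈ T.map φ) : ∃ b ∈ T, φ b = β := by
  -- Successive approximation; it stops after `m` steps because `I₀ ^ m * T` vanishes.
  have key : ∀ n : ℕ, ∃ b ∈ T, β - φ b ∈ (I₀ ^ n * T).map φ := by
    intro n
    induction n with
    | zero => exact ⟨0, zero_mem _, by
        rwa [pow_zero, one_mul, map_zero, sub_zero]⟩
    | succ n ih =>
      obtain ⟨b, hb, hβb⟩ := ih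
      obtain ⟨c, hc, hβc⟩ := h.exists_sub_mem_map_mul hβb
      have hle : I₀ ^ n * T ≤ T := Ideal.mul_le_right
      refine ⟨b + c, add_mem hb (hle hc), ?_⟩
      rw [pow_succ', mul_assoc, map_add, ← sub_sub]
      exact hβc
  obtain ⟨b, hb, hβb⟩ := key m
  rw [hT, Ideal.map_bot, Ideal.mem_bot, sub_eq_zero] at hβb
  exact ⟨b, hb, hβb.symm⟩

/-- Solutions in the henselization of a linear system come from `I₀`-adic approximate solutions. -/
theorem exists_approximate_solution (h : IsHenselization I₀ I φ) {T : Ideal A₀} {m : ℕ}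
    (hT : I₀ ^ m * T = ⊥) {r s x : A₀} (hs : ∀ a, s * a = 0 → a ∈ T) {β : A}
    (hβs : φ s * β = 0) (hβr : φ r * β = 0) (hβx : β - φ x ∈ I) :
    ∃ b, (∀ n, r * b ∈ I₀ ^ n) ∧ b - x ∈ I₀ := by
  obtain ⟨b, -, rfl⟩ := h.exists_eq_of_mem_map hT (h.mem_map_of_mul_eq_zero hs hβs)
  refine ⟨b, fun n => h.comap_pow n ?_, ?_⟩
  · rw [Ideal.mem_comap, map_mul, hβr]
    exact zero_mem _
  · rw [← map_sub] at hβx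
    exact h.2.1.le hβx

end IsHenselization

/-! ### The explicit rings -/

section Rings

variable (k : Type u) [Field k]

theorem xR_zero_mul_yR : xR k 0 * yR k = 0 := by
  rw [xR, yR, ← map_mul]
  exact Ideal.Quotient.eq_zero_iff_mem.2 (Ideal.subset_span (Or.inl rfl))

theorem xR_succ_mul_yR (i : ℕ) : xR k (i + 1) * yR k = xR k i := by
  rw [xR, yR, ← map_mul, eq_comm]
  exact Ideal.Quotient.eq.2 (Ideal.subset_span (Or.inr ⟨i, rfl⟩))

theorem yR_pow_mul_xR {i j : ℕ} (h : i < j) : yR k ^ j * xR k i = 0 := by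
  induction j generalizing i with
  | zero => omega
  | succ j ih =>
    rw [pow_succ, mul_assoc, mul_comm (yR k)]
    cases i with
    | zero => rw [xR_zero_mul_yR, mul_zero]
    | succ i => rw [xR_succ_mul_yR, ih (by omega)]

/-- The model is `k[X] / (X^(m+1))` with `y ↦ X` and `xᵢ ↦ X^(m-i)`, where `x₀ ↦ X^m ≠ 0`. It
respects only the relations with `i < m`, because subtraction truncates, but an element of the ideal
involves finitely many relations, so a large `m` suffices. -/
theorem xR_zero_ne_zero : xR k 0 ≠ 0 := by
  intro h
  have hmem : MvPolynomial.X (some 0) ∈ idealA k := Ideal.Quotient.eq_zero_iff_mem.1 h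
  have key : ∀ f ∈ idealA k, ∃ N : ℕ, ∀ m, N ≤ m → (Polynomial.X : Polynomial k) ^ (m + 1) ∣
      MvPolynomial.aeval (fun o : Option ℕ => o.elim (Polynomial.X : Polynomial k)
        fun i => Polynomial.X ^ (m - i)) f := by
    intro f hf
    refine Submodule.span_induction ?_ ⟨0, by simp⟩ ?_ ?_ hf
    · rintro _ (rfl | ⟨i, rfl⟩)
      · exact ⟨0, fun m _ => by simp [pow_succ]⟩
      · refine ⟨i + 1, fun m hm => ?_⟩
        have : m - i = m - (i + 1) + 1 := by omega
        simp [this, pow_succ]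
    · rintro a b - - ⟨N, hN⟩ ⟨M, hM⟩
      refine ⟨max N M, fun m hm => ?_⟩
      rw [map_add]
      exact dvd_add (hN m (le_trans (le_max_left _ _) hm)) (hM m (le_trans (le_max_right _ _) hm))
    · rintro a b - ⟨N, hN⟩
      refine ⟨N, fun m hm => ?_⟩
      rw [smul_eq_mul, map_mul]
      exact (hN m hm).mul_left _
  obtain ⟨N, hN⟩ := key _ hmem
  have := hN N le_rfl
  rw [MvPolynomial.aeval_X] at this
  exact absurd ((pow_dvd_pow_iff Polynomial.X_ne_zero Polynomial.not_isUnit_X).1 this) (by simp)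

/-! ### Torsion and approximate solutions in the first ring. -/

/-- The ideal `(xᵢ : i < m)` of `R`. -/
def xIdeal (m : ℕ) : Ideal (RingR k) := Ideal.span (xR k '' Set.Iio m)

theorem xIdeal_mono : Monotone (xIdeal k) := fun _ _ h =>
  Ideal.span_mono (Set.image_mono (Set.Iio_subset_Iio h))

theorem yR_pow_mul_eq_zero {m : ℕ} {r : RingR k} (hr : r ∈ xIdeal k m) : yR k ^ m * r = 0 := by
  refine Submodule.span_induction ?_ (mul_zero _) ?_ ?_ hr
  · rintro _ ⟨i, hi, rfl⟩
    exact yR_pow_mul_xR k hi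
  · intro a b _ _ ha hb
    rw [mul_add, ha, hb, add_zero]
  · intro a b _ hb
    rw [smul_eq_mul, mul_left_comm, hb, mul_zero]

/-- A generator `xᵢ t^(i+2)` contributes only in degrees `j ≥ i + 2`, that is for `i < j - 1`.
Truncated subtraction gives the zero ideal in degrees `0` and `1`, as it should. -/
theorem coeff_mem_of_mem_idealN {f : Polynomial (RingR k)} (hf : f ∈ idealN k) (j : ℕ) :
    f.coeff j ∈ xIdeal k (j - 1) := by
  induction hf using Submodule.span_induction generalizing j with
  | mem f hf =>
    obtain ⟨i, rfl⟩ := hf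
    rw [Polynomial.coeff_C_mul_X_pow]
    split_ifs with h
    · exact Ideal.subset_span ⟨i, by simp only [Set.mem_Iio]; omega, rfl⟩
    · exact zero_mem _
  | zero => simp
  | add a b _ _ ha hb => rw [Polynomial.coeff_add]; exact add_mem (ha j) (hb j)
  | smul a b _ hb =>
    rw [smul_eq_mul, Polynomial.coeff_mul]
    refine Ideal.sum_mem _ fun p hp => Ideal.mul_mem_left _ _ (xIdeal_mono k ?_ (hb p.2))
    have := Finset.HasAntidiagonal.mem_antidiagonal.1 hp
    omega

/-- The ideal `(xᵢ tⁱ : i ≥ 0)` of `R[t] / 𝔫`. -/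
def torsionIdeal : Ideal (RingA₀ k) := Ideal.span (Set.range fun i => xA₀ k i * tA₀ k ^ i)

/-- The degree `j` coefficient of a representative is the degree `j + 2` coefficient after
multiplication by `t²`. It therefore involves only `xᵢ` with `i ≤ j`, and each `xᵢ tʲ` is a multiple
of `xᵢ tⁱ`. -/
theorem mem_torsionIdeal_of_sq_mul {a : RingA₀ k} (ha : tA₀ k ^ 2 * a = 0) :
    a ∈ torsionIdeal k := by
  obtain ⟨f, rfl⟩ := Ideal.Quotient.mk_surjective a
  rw [tA₀, ← map_pow, ← map_mul, Ideal.Quotient.eq_zero_iff_mem] at ha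
  have hf : ∀ j, f.coeff j ∈ xIdeal k (j + 1) := fun j => by
    have := coeff_mem_of_mem_idealN k ha (j + 2)
    rwa [Polynomial.coeff_X_pow_mul] at this
  rw [f.as_sum_range_C_mul_X_pow, map_sum]
  refine Ideal.sum_mem _ fun j _ => ?_
  refine Submodule.span_induction (p := fun r _ => Ideal.Quotient.mk (idealN k)
    (Polynomial.C r * Polynomial.X ^ j) ∈ torsionIdeal k) ?_ (by simp) ?_ ?_ (hf j)
  · rintro _ ⟨i, hi, rfl⟩
    obtain ⟨l, rfl⟩ := Nat.exists_eq_add_of_le (Nat.lt_succ_iff.1 hi)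
    rw [pow_add, ← mul_assoc, map_mul]
    exact Ideal.mul_mem_right _ _ (Ideal.subset_span ⟨i, by simp [xA₀, tA₀]⟩)
  · intro a b _ _ ha hb
    rw [map_add, add_mul, map_add]
    exact add_mem ha hb
  · intro a b _ hb
    rw [smul_eq_mul, Polynomial.C_mul, mul_assoc, map_mul]
    exact Ideal.mul_mem_left _ _ hb

theorem xA₀_mul_tA₀_pow (i : ℕ) : xA₀ k i * tA₀ k ^ (i + 2) = 0 := by
  rw [xA₀, tA₀, ← map_pow, ← map_mul, Ideal.Quotient.eq_zero_iff_mem]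
  exact Ideal.subset_span ⟨i, rfl⟩

theorem xA₀_zero_mul_yA₀ : xA₀ k 0 * yA₀ k = 0 := by
  rw [xA₀, yA₀, ← map_mul, ← map_mul, xR_zero_mul_yR, map_zero, map_zero]

theorem xA₀_succ_mul_yA₀ (i : ℕ) : xA₀ k (i + 1) * yA₀ k = xA₀ k i := by
  rw [xA₀, yA₀, ← map_mul, ← map_mul, xR_succ_mul_yR, xA₀]

theorem sq_mul_torsionIdeal : Ideal.span {tA₀ k} ^ 2 * torsionIdeal k = ⊥ := by
  rw [Ideal.span_singleton_pow, torsionIdeal, Ideal.span_mul_span', eq_bot_iff, Ideal.span_le]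
  rintro _ ⟨_, rfl, _, ⟨i, rfl⟩, rfl⟩
  have := xA₀_mul_tA₀_pow k i
  simp only [SetLike.mem_coe, Ideal.mem_bot]
  rw [← this]; ring

/-- The system `(t - y) X = 0` has no `t`-adic approximate solution congruent to `x₀`. -/
theorem not_approximate_solution {b : RingA₀ k}
    (hb : ∀ n, (tA₀ k - yA₀ k) * b ∈ Ideal.span {tA₀ k} ^ n)
    (hx : b - xA₀ k 0 ∈ Ideal.span {tA₀ k}) : False := by
  -- Below degree `n`, a multiple of `tⁿ` contributes nothing, so only `𝔫` constrains the
  -- coefficients.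
  have hlift : ∀ {n : ℕ} {g : Polynomial (RingR k)},
      Ideal.Quotient.mk (idealN k) g ∈ Ideal.span {tA₀ k} ^ n → ∀ j, j < n →
      g.coeff j ∈ xIdeal k (j - 1) := by
    intro n g hg j hj
    rw [Ideal.span_singleton_pow, Ideal.mem_span_singleton'] at hg
    obtain ⟨a, ha⟩ := hg
    obtain ⟨a, rfl⟩ := Ideal.Quotient.mk_surjective a
    rw [tA₀, ← map_pow, ← map_mul, eq_comm, Ideal.Quotient.eq] at ha
    have := coeff_mem_of_mem_idealN k ha j
    rwa [Polynomial.coeff_sub, Polynomial.coeff_mul_X_pow', if_neg (by omega), sub_zero] at this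
  obtain ⟨f, rfl⟩ := Ideal.Quotient.mk_surjective b
  have h0 : f.coeff 0 = xR k 0 := by
    rw [xA₀, ← map_sub, ← pow_one (Ideal.span _)] at hx
    have := hlift hx 0 one_pos
    simpa [xIdeal, sub_eq_zero] using this
  -- The degree `j + 1` coefficient of `(t - y) f` is `fⱼ - y fⱼ₊₁`. It lies in `(xᵢ : i < j)`,
  -- which `yʲ` kills, so `yʲ fⱼ = yʲ⁺¹ fⱼ₊₁`.
  have h1 : ∀ j, yR k ^ j * f.coeff j = xR k 0 := by
    intro j
    induction j with
    | zero => rw [pow_zero, one_mul, h0]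
    | succ j ih =>
      have h2 := hb (j + 2)
      rw [tA₀, yA₀, ← map_sub, ← map_mul] at h2
      have h3 := yR_pow_mul_eq_zero k (hlift h2 (j + 1) (by omega))
      rw [sub_mul, Polynomial.coeff_sub, Polynomial.coeff_X_mul, Polynomial.coeff_C_mul,
        Nat.add_sub_cancel, mul_sub, ih, sub_eq_zero] at h3
      rw [h3]; ring
  refine xR_zero_ne_zero k ?_
  rw [← h1 (f.natDegree + 1), Polynomial.coeff_eq_zero_of_natDegree_lt (Nat.lt_succ_self _),
    mul_zero]

/-! ### The second ring -/

/-- The bound depends on the exponent of `t` alone, so it survives division by powers of `u`. The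
generator `xᵢ tⁱ u` dictates `d 0 + 1`; the generators of `𝔫` satisfy a stronger bound. -/
theorem coeff_mem_of_mem_idealN₂_add_idealN' {f : MvPolynomial (Fin 2) (RingR k)}
    (hf : f ∈ idealN₂ k + idealN' k) (d : Fin 2 →₀ ℕ) : f.coeff d ∈ xIdeal k (d 0 + 1) := by
  rw [idealN₂, idealN', Submodule.add_eq_sup, ← Ideal.span_union] at hf
  induction hf using Submodule.span_induction generalizing d with
  | mem f hf =>
    rcases hf with ⟨i, rfl⟩ | ⟨i, rfl⟩
    · simp only
      rw [MvPolynomial.coeff_C_mul, MvPolynomial.coeff_X_pow]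
      split_ifs with h
      · refine Ideal.mul_mem_right _ _ (Ideal.subset_span ⟨i, ?_, rfl⟩)
        simp [← h]
      · simp
    · simp only
      rw [mul_assoc, MvPolynomial.coeff_C_mul, ← pow_one (MvPolynomial.X 1),
        MvPolynomial.X_pow_eq_monomial, MvPolynomial.X_pow_eq_monomial,
        MvPolynomial.monomial_mul, MvPolynomial.coeff_monomial]
      split_ifs with h
      · refine Ideal.mul_mem_right _ _ (Ideal.subset_span ⟨i, ?_, rfl⟩)
        simp [← h]
      · simp
  | zero => simp
  | add a b _ _ ha hb => rw [MvPolynomial.coeff_add]; exact add_mem (ha d) (hb d)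
  | smul a b _ hb =>
    rw [smul_eq_mul, MvPolynomial.coeff_mul]
    refine Ideal.sum_mem _ fun p hp => Ideal.mul_mem_left _ _ (xIdeal_mono k ?_ (hb p.2))
    have := Finset.HasAntidiagonal.mem_antidiagonal.1 hp
    simp [← this]

/-- The ideal `(xᵢ tⁱ : i ≥ 0)` of `R[t, u] / (𝔫 + 𝔫')`. -/
def torsionIdeal' : Ideal (RingA₀' k) := Ideal.span (Set.range fun i => xA₀' k i * tA₀' k ^ i)

theorem mem_torsionIdeal'_of_pow_mul {a : RingA₀' k} {m : ℕ} (ha : uA₀' k ^ m * a = 0) :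
    a ∈ torsionIdeal' k := by
  obtain ⟨f, rfl⟩ := Ideal.Quotient.mk_surjective a
  rw [uA₀', ← map_pow, ← map_mul, Ideal.Quotient.eq_zero_iff_mem] at ha
  have hf : ∀ d, f.coeff d ∈ xIdeal k (d 0 + 1) := fun d => by
    have := coeff_mem_of_mem_idealN₂_add_idealN' k ha (Finsupp.single 1 m + d)
    rw [MvPolynomial.X_pow_eq_monomial, MvPolynomial.coeff_monomial_mul, one_mul] at this
    simpa using this
  rw [f.as_sum, map_sum]
  refine Ideal.sum_mem _ fun d _ => ?_
  refine Submodule.span_induction (p := fun r _ => Ideal.Quotient.mk (idealN₂ k + idealN' k)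
    (MvPolynomial.monomial d r) ∈ torsionIdeal' k) ?_ (by simp) ?_ ?_ (hf d)
  · rintro _ ⟨i, hi, rfl⟩
    obtain ⟨l, hl⟩ := Nat.exists_eq_add_of_le (Nat.lt_succ_iff.1 hi)
    rw [MvPolynomial.monomial_eq, Finsupp.prod_fintype _ _ (by simp), Fin.prod_univ_two, hl,
      pow_add, mul_assoc, ← mul_assoc, map_mul]
    exact Ideal.mul_mem_right _ _ (Ideal.subset_span ⟨i, by simp [xA₀', tA₀']⟩)
  · intro a b _ _ ha hb
    rw [map_add, map_add]
    exact add_mem ha hb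
  · intro a b _ hb
    rw [smul_eq_mul, ← MvPolynomial.C_mul_monomial, map_mul]
    exact Ideal.mul_mem_left _ _ hb

theorem xA₀'_mul_tA₀'_pow (i : ℕ) : xA₀' k i * tA₀' k ^ (i + 2) = 0 := by
  rw [xA₀', tA₀', ← map_pow, ← map_mul, Ideal.Quotient.eq_zero_iff_mem]
  exact Ideal.mem_sup_left (Ideal.subset_span ⟨i, rfl⟩)

theorem xA₀'_mul_tA₀'_pow_mul_uA₀' (i : ℕ) : xA₀' k i * tA₀' k ^ i * uA₀' k = 0 := by
  rw [xA₀', tA₀', uA₀', ← map_pow, ← map_mul, ← map_mul, Ideal.Quotient.eq_zero_iff_mem]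
  exact Ideal.mem_sup_right (Ideal.subset_span ⟨i, rfl⟩)

theorem xA₀'_zero_mul_yA₀' : xA₀' k 0 * yA₀' k = 0 := by
  rw [xA₀', yA₀', ← map_mul, ← map_mul, xR_zero_mul_yR, map_zero, map_zero]

theorem xA₀'_succ_mul_yA₀' (i : ℕ) : xA₀' k (i + 1) * yA₀' k = xA₀' k i := by
  rw [xA₀', yA₀', ← map_mul, ← map_mul, xR_succ_mul_yR, xA₀']

theorem sq_mul_torsionIdeal' :
    Ideal.span {tA₀' k, uA₀' k} ^ 2 * torsionIdeal' k = ⊥ := by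
  rw [pow_two, Ideal.span_mul_span', torsionIdeal', Ideal.span_mul_span', eq_bot_iff, Ideal.span_le]
  rintro _ ⟨_, ⟨a, ha, b, hb, rfl⟩, _, ⟨i, rfl⟩, rfl⟩
  have h1 := xA₀'_mul_tA₀'_pow k i
  have h2 := xA₀'_mul_tA₀'_pow_mul_uA₀' k i
  simp only [SetLike.mem_coe, Ideal.mem_bot]
  rcases ha with rfl | rfl <;> rcases hb with rfl | rfl
  · rw [← h1]; ring
  · linear_combination tA₀' k * h2
  · linear_combination tA₀' k * h2
  · linear_combination uA₀' k * h2

/-- The reduction modulo `u`. -/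
def modU : RingA₀' k →+* RingA₀ k :=
  Ideal.Quotient.lift _
    (MvPolynomial.eval₂Hom ((Ideal.Quotient.mk (idealN k)).comp Polynomial.C) ![tA₀ k, 0]) <| by
  intro a ha
  rw [← RingHom.mem_ker]
  refine (sup_le (Ideal.span_le.2 ?_) (Ideal.span_le.2 ?_) : idealN₂ k + idealN' k ≤ _) ha
  · rintro _ ⟨i, rfl⟩
    rw [SetLike.mem_coe, RingHom.mem_ker]
    simpa [xA₀] using xA₀_mul_tA₀_pow k i
  · rintro _ ⟨i, rfl⟩
    simp [RingHom.mem_ker]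

theorem modU_tA₀' : modU k (tA₀' k) = tA₀ k := by
  rw [modU, tA₀', Ideal.Quotient.lift_mk]; simp

theorem modU_uA₀' : modU k (uA₀' k) = 0 := by
  rw [modU, uA₀', Ideal.Quotient.lift_mk]; simp

theorem modU_yA₀' : modU k (yA₀' k) = yA₀ k := by
  rw [modU, yA₀', Ideal.Quotient.lift_mk]; simp [yA₀]

theorem modU_xA₀' (i : ℕ) : modU k (xA₀' k i) = xA₀ k i := by
  rw [modU, xA₀', Ideal.Quotient.lift_mk]; simp [xA₀]

/-- The system `(t - y) X = 0` has no `(t, u)`-adic approximate solution congruent to `x₀`. -/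
theorem not_approximate_solution' {b : RingA₀' k}
    (hb : ∀ n, (tA₀' k - yA₀' k) * b ∈ Ideal.span {tA₀' k, uA₀' k} ^ n)
    (hx : b - xA₀' k 0 ∈ Ideal.span {tA₀' k, uA₀' k}) : False := by
  have hmap : (Ideal.span {tA₀' k, uA₀' k}).map (modU k) = Ideal.span {tA₀ k} := by
    rw [Ideal.map_span, Set.image_pair, modU_tA₀', modU_uA₀', Set.pair_comm, Ideal.span_insert_zero]
  refine not_approximate_solution k (b := modU k b) (fun n => ?_) ?_
  · have := Ideal.mem_map_of_mem (modU k) (hb n)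
    rwa [Ideal.map_pow, hmap, map_mul, map_sub, modU_tA₀', modU_yA₀'] at this
  · have := Ideal.mem_map_of_mem (modU k) hx
    rwa [hmap, map_sub, modU_xA₀'] at this

end Rings

/-! ### Sections of linear systems -/

section System

variable {A : Type u} [CommRing A] {I : Ideal A}

theorem exists_isAdicSum {a : ℕ → A} (ha : ∀ i, a i ∈ I ^ i) :
    ∃ α : AdicCompletion I A, IsAdicSum I a α := by
  refine ⟨AdicCompletion.mk I A (AdicCompletion.AdicCauchySequence.mk I A
    (fun n => ∑ i ∈ Finset.range n, a i) fun n => ?_), ha, fun n => ?_⟩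
  · rw [SModEq.sub_mem, Finset.sum_range_succ, smul_eq_mul, Ideal.mul_top]
    simpa using ha n
  · rw [AdicCompletion.evalₐ_mk]
    rfl

theorem IsAdicSum.algebraMap_mul_eq_zero {a : ℕ → A} {α : AdicCompletion I A}
    (h : IsAdicSum I a α) {c : A} (hc : ∀ n, c * ∑ i ∈ Finset.range n, a i ∈ I ^ n) :
    algebraMap A (AdicCompletion I A) c * α = 0 := by
  refine AdicCompletion.ext_evalₐ fun n => ?_
  rw [map_mul, h.2 n, AlgHom.commutes, map_zero, Ideal.Quotient.algebraMap_eq, ← map_mul,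
    Ideal.Quotient.eq_zero_iff_mem]
  exact hc n

/-- Modulo `I` only the term of index `0` of the series remains. -/
theorem IsAdicSum.sub_mem {a : ℕ → A} {α : AdicCompletion I A}
    (h : IsAdicSum I a α) {β : A} (hβ : algebraMap A (AdicCompletion I A) β - α ∈
      I.map (algebraMap A (AdicCompletion I A))) : β - a 0 ∈ I := by
  have h1 := Ideal.mem_map_of_mem (AdicCompletion.evalₐ I 1 : _ →+* A ⧸ I ^ 1) hβ
  have hI : I.map (Ideal.Quotient.mk (I ^ 1)) = ⊥ :=
    le_bot_iff.1 ((Ideal.map_mono (pow_one I).ge).trans (Ideal.map_quotient_self _).le)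
  rw [Ideal.map_map, AlgHom.comp_algebraMap, Ideal.Quotient.algebraMap_eq, hI,
    Ideal.mem_bot] at h1
  have h2 := h.2 1
  rw [RingHom.coe_coe, map_sub, h2, AlgHom.commutes, Ideal.Quotient.algebraMap_eq, ← map_sub,
    Ideal.Quotient.eq_zero_iff_mem, pow_one] at h1
  simpa using h1

theorem mem_complV_map {C : Type u} [CommRing C] {f : A →+* C} {q : PrimeSpectrum C} :
    q ∈ complV (I.map f) ↔ ∃ a ∈ I, f a ∉ q.asIdeal := by
  change ¬ ((I.map f : Set C) ⊆ q.asIdeal) ↔ _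
  rw [SetLike.coe_subset_coe, Ideal.map_le_iff_le_comap, SetLike.not_le_iff_exists]
  rfl

variable {S : Set A}

theorem SystemAlgebra.algebraMap_mul_gen {a : A} (ha : a ∈ Ideal.span S) :
    algebraMap A (SystemAlgebra S) a * SystemAlgebra.gen S = 0 := by
  refine Submodule.span_induction (p := fun a _ =>
    algebraMap A (SystemAlgebra S) a * SystemAlgebra.gen S = 0) ?_ (by simp) ?_ ?_ ha
  · intro a ha
    exact Ideal.Quotient.eq_zero_iff_mem.2 (Ideal.subset_span ⟨a, ha, rfl⟩)
  · intro a b _ _ ha hb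
    rw [map_add, add_mul, ha, hb, add_zero]
  · intro a b _ hb
    rw [smul_eq_mul, map_mul, mul_assoc, hb, mul_zero]

theorem SystemAlgebra.algHom_ext {C : Type u} [CommRing C] [Algebra A C]
    {f g : SystemAlgebra S →ₐ[A] C} (h : f (gen S) = g (gen S)) : f = g :=
  Ideal.Quotient.algHom_ext _ (Polynomial.algHom_ext h)

/-- The section of the system algebra given by a solution. -/
theorem SystemAlgebra.exists_algHom {C : Type u} [CommRing C] [Algebra A C] (x : C)
    (hx : ∀ a ∈ S, algebraMap A C a * x = 0) : ∃ f : SystemAlgebra S →ₐ[A] C, f (gen S) = x := by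
  refine ⟨Ideal.Quotient.liftₐ _ (Polynomial.aeval x) fun p hp => ?_, Polynomial.aeval_X x⟩
  refine (Ideal.span_le (I := RingHom.ker (Polynomial.aeval (R := A) x))).2 ?_ hp
  rintro _ ⟨a, ha, rfl⟩
  rw [SetLike.mem_coe, RingHom.mem_ker]
  simpa using hx a ha

theorem SystemAlgebra.finitePresentation (hS : S.Finite) :
    Algebra.FinitePresentation A (SystemAlgebra S) :=
  Algebra.FinitePresentation.quotient (Submodule.fg_span (hS.image _))

/-- Where an element of the radical of the ideal of coefficients is inverted, the only solution of
the system is zero. -/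
theorem SystemAlgebra.basicOpen_subset_smoothLocus (hS : S.Finite) {a : A}
    (ha : a ∈ (Ideal.span S).radical) :
    (PrimeSpectrum.basicOpen (algebraMap A (SystemAlgebra S) a) : Set _) ⊆
      Algebra.smoothLocus A (SystemAlgebra S) := by
  have := finitePresentation hS
  rw [Algebra.basicOpen_subset_smoothLocus_iff]
  obtain ⟨m, hm⟩ := ha
  set b := algebraMap A (SystemAlgebra S) a
  have hb := IsLocalization.Away.algebraMap_isUnit (S := Localization.Away b) b
  -- A power of `a` lies in the coefficient ideal, so inverting `a` forces the generator to vanish.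
  -- The localization of the system algebra is then that of `A`, with inverse maps `f` and `g`.
  have hgen : algebraMap _ (Localization.Away b) (gen S) = 0 := by
    have := congrArg (algebraMap _ (Localization.Away b)) (algebraMap_mul_gen hm)
    rw [map_pow, map_mul, map_pow, map_zero] at this
    exact (hb.pow m).mul_right_eq_zero.1 this
  obtain ⟨z, hz⟩ := exists_algHom (S := S) (0 : Localization.Away a) (by simp)
  have hua : IsUnit (Algebra.ofId A (Localization.Away b) a) := by
    rw [Algebra.ofId_apply, IsScalarTower.algebraMap_apply A (SystemAlgebra S)]
    exact hb
  have hzb : IsUnit (z b) := by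
    rw [z.commutes]
    exact IsLocalization.Away.algebraMap_isUnit a
  have hpow : ∀ {B C : Type u} [CommRing B] [CommRing C] [Algebra A B] [Algebra A C]
      (f : B →ₐ[A] C) (b : B), IsUnit (f b) → ∀ y : Submonoid.powers b, IsUnit (f y) := by
    rintro B C _ _ _ _ f b h ⟨_, n, rfl⟩
    simpa using h.pow n
  let f : Localization.Away a →ₐ[A] Localization.Away b :=
    IsLocalization.liftAlgHom (M := Submonoid.powers a) (hpow (Algebra.ofId A _) a hua)
  let g : Localization.Away b →ₐ[A] Localization.Away a :=
    IsLocalization.liftAlgHom (M := Submonoid.powers b) (hpow z b hzb)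
  have hg : ∀ x, g (algebraMap _ _ x) = z x := fun x => IsLocalization.lift_eq _ x
  refine Algebra.FormallySmooth.of_equiv (A := Localization.Away a) (AlgEquiv.ofAlgHom f g ?_ ?_)
  · refine IsLocalization.algHom_ext (Submonoid.powers b) (algHom_ext ?_)
    change f (g (algebraMap _ _ (gen S))) = algebraMap _ _ (gen S)
    rw [hg, hz, map_zero, hgen]
  · exact (IsLocalization.algHom_subsingleton (Submonoid.powers a)).elim _ _

/-- The radical hypothesis gives smoothness of `V`. The section condition is automatic because `V`
is the preimage of the complement of `V(I)`, so only the absence of a congruent solution has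
content. -/
theorem systemRefutes (hS : S.Finite) (hI : I ≤ (Ideal.span S).radical) {α : AdicCompletion I A}
    (hα : ∀ a ∈ S, algebraMap A (AdicCompletion I A) a * α = 0)
    (hno : ∀ β : A, (∀ a ∈ S, a * β = 0) →
      algebraMap A (AdicCompletion I A) β - α ∉ I.map (algebraMap A (AdicCompletion I A))) :
    SystemRefutes I S α := by
  obtain ⟨σ, hσ⟩ := SystemAlgebra.exists_algHom α hα
  let ε' : AdicCompletion I A ⊗[A] SystemAlgebra S →ₐ[AdicCompletion I A] AdicCompletion I A :=
    Algebra.TensorProduct.lift (AlgHom.id _ _) σ fun _ _ => Commute.all _ _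
  have hε' : ∀ b, ε' (1 ⊗ₜ b) = σ b := fun b => by simp [ε']
  refine ⟨hα, ⟨ε', by rw [hε', hσ], ⟨SystemAlgebra.finitePresentation hS, ?_, ?_⟩, ?_⟩, ?_⟩
  · intro p hp
    obtain ⟨a, ha, hap⟩ := mem_complV_map.1 hp
    exact SystemAlgebra.basicOpen_subset_smoothLocus hS (hI ha) hap
  · intro q hq
    obtain ⟨a, ha, haq⟩ := mem_complV_map.1 hq
    refine mem_complV_map.2 ⟨a, ha, fun h => haq ?_⟩
    have h' : ε' (1 ⊗ₜ algebraMap A (SystemAlgebra S) a) ∈ q.asIdeal := h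
    rwa [hε', σ.commutes] at h'
  · rintro ⟨ε, hε, -⟩
    refine hno (ε (SystemAlgebra.gen S)) (fun a ha => ?_) ?_
    · have := congrArg ε (SystemAlgebra.algebraMap_mul_gen (Ideal.subset_span ha))
      rwa [map_mul, ε.commutes, map_zero] at this
    · have := hε (SystemAlgebra.gen S)
      rwa [hε', hσ, pow_one] at this
  · rintro ⟨β, hβ, h⟩
    exact hno β hβ h

/-- The partial sums of `∑ xᵢ tⁱ` are approximate solutions of `(t - y) X = 0`. -/
theorem sub_mul_sum_mem {t y : A} {x : ℕ → A} (ht : t ∈ I) (h0 : x 0 * y = 0)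
    (h1 : ∀ i, x (i + 1) * y = x i) (n : ℕ) :
    (t - y) * ∑ i ∈ Finset.range n, x i * t ^ i ∈ I ^ n := by
  -- The product telescopes to its top term.
  have key : ∀ n, (t - y) * ∑ i ∈ Finset.range (n + 1), x i * t ^ i = x n * t ^ (n + 1) := by
    intro n
    induction n with
    | zero => simp; linear_combination -h0
    | succ n ih =>
      rw [Finset.sum_range_succ, mul_add, ih]
      linear_combination (-t ^ (n + 1)) * h1 n
  cases n with
  | zero => simp
  | succ n =>
    rw [key]
    exact Ideal.mul_mem_left _ _ (Ideal.pow_mem_pow ht _)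

end System

/-! ### The first ring is noetherian outside `t = 0` -/

theorem isNoetherianOutside_span_singleton {A : Type u} [CommRing A] (t : A)
    [IsNoetherianRing (Localization.Away t)] : IsNoetherianOutside (Ideal.span {t}) := by
  have hV : complV (Ideal.span {t}) = PrimeSpectrum.basicOpen t := by
    ext p
    simp [complV]
  let U : (AlgebraicGeometry.Spec (CommRingCat.of A)).Opens := PrimeSpectrum.basicOpen t
  have hU : AlgebraicGeometry.IsNoetherian (U : AlgebraicGeometry.Scheme.{u}) := by
    let e := AlgebraicGeometry.basicOpenIsoSpecAway (R := CommRingCat.of A) t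
    have : AlgebraicGeometry.IsLocallyNoetherian (U : AlgebraicGeometry.Scheme.{u}) :=
      AlgebraicGeometry.isLocallyNoetherian_of_isOpenImmersion e.hom
    have : CompactSpace (U : AlgebraicGeometry.Scheme.{u}) :=
      isCompact_iff_compactSpace.1 (PrimeSpectrum.isCompact_basicOpen t)
    exact {}
  rw [IsNoetherianOutside, hV]
  exact hU

/-- From `xᵢ t^(i+2) = 0`, every `xᵢ` dies once `t` is inverted. The localization is then a quotient
of `k[t, y]` with `t` inverted; surjectivity alone is needed. -/
theorem isNoetherianRing_away_tA₀ (k : Type u) [Field k] :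
    IsNoetherianRing (Localization.Away (tA₀ k)) := by
  let L := Localization.Away (tA₀ k)
  let c : k →+* RingA₀ k := (Ideal.Quotient.mk (idealN k)).comp
    (Polynomial.C.comp ((toRingR k).comp MvPolynomial.C))
  let h : MvPolynomial (Fin 2) k →+* RingA₀ k := MvPolynomial.eval₂Hom c ![tA₀ k, yA₀ k]
  have ht : h (MvPolynomial.X 0) = tA₀ k := by simp [h]
  have hu : IsUnit (algebraMap (RingA₀ k) L (tA₀ k)) := IsLocalization.Away.algebraMap_isUnit _
  have hx : ∀ i, algebraMap (RingA₀ k) L (xA₀ k i) = 0 := fun i => by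
    have := congrArg (algebraMap (RingA₀ k) L) (xA₀_mul_tA₀_pow k i)
    rw [map_mul, map_pow, map_zero] at this
    exact (hu.pow _).mul_left_eq_zero.1 this
  have hsurj : ∀ a, ∃ p, algebraMap (RingA₀ k) L a = algebraMap (RingA₀ k) L (h p) := by
    suffices ∀ a, algebraMap (RingA₀ k) L a ∈ ((algebraMap (RingA₀ k) L).comp h).range by
      intro a
      obtain ⟨p, hp⟩ := this a
      exact ⟨p, hp.symm⟩
    intro a
    obtain ⟨f, rfl⟩ := Ideal.Quotient.mk_surjective a
    induction f using Polynomial.induction_on' with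
    | add f g hf hg => rw [map_add, map_add]; exact add_mem hf hg
    | monomial n r =>
      rw [← Polynomial.C_mul_X_pow_eq_monomial, map_mul, map_mul, map_pow, map_pow]
      have hX : algebraMap (RingA₀ k) L (Ideal.Quotient.mk (idealN k) Polynomial.X) ∈
          ((algebraMap (RingA₀ k) L).comp h).range :=
        ⟨MvPolynomial.X 0, by rw [RingHom.comp_apply, ht]; rfl⟩
      refine mul_mem ?_ (pow_mem hX _)
      obtain ⟨p, rfl⟩ : ∃ p, toRingR k p = r := Ideal.Quotient.mk_surjective r
      induction p using MvPolynomial.induction_on with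
      | C r => exact ⟨MvPolynomial.C r, by simp [h, c]⟩
      | add f g hf hg => rw [map_add, map_add, map_add, map_add]; exact add_mem hf hg
      | mul_X f o hf =>
        rw [map_mul, map_mul, map_mul, map_mul]
        refine mul_mem hf ?_
        cases o with
        | none => exact ⟨MvPolynomial.X 1, by simp [h, yA₀, yR]⟩
        | some i =>
          have := hx i
          rw [xA₀, xR] at this
          rw [this]
          exact zero_mem _
  let g : Localization.Away (MvPolynomial.X 0 : MvPolynomial (Fin 2) k) →+* L :=
    IsLocalization.Away.lift (MvPolynomial.X 0) (g := (algebraMap (RingA₀ k) L).comp h)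
      (by rw [RingHom.comp_apply, ht]; exact hu)
  have : IsNoetherianRing (Localization.Away (MvPolynomial.X 0 : MvPolynomial (Fin 2) k)) :=
    IsLocalization.isNoetherianRing (Submonoid.powers (MvPolynomial.X 0 : MvPolynomial (Fin 2) k)) _
      inferInstance
  refine isNoetherianRing_of_surjective _ _ g fun z => ?_
  obtain ⟨n, a, hz⟩ := IsLocalization.Away.surj (tA₀ k) z
  obtain ⟨p, hp⟩ := hsurj a
  have hg : ∀ q, g (algebraMap _ _ q) = algebraMap (RingA₀ k) L (h q) := fun q =>
    IsLocalization.Away.lift_eq _ _ q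
  refine ⟨algebraMap _ _ p * IsLocalization.Away.invSelf (MvPolynomial.X 0 : MvPolynomial (Fin 2) k) ^ n, ?_⟩
  refine (hu.pow n).mul_right_cancel ?_
  have hinv : g (IsLocalization.Away.invSelf (MvPolynomial.X 0 : MvPolynomial (Fin 2) k)) *
      algebraMap (RingA₀ k) L (tA₀ k) = 1 := by
    have := congrArg g (IsLocalization.Away.mul_invSelf
      (S := Localization.Away (MvPolynomial.X 0 : MvPolynomial (Fin 2) k))
      (MvPolynomial.X 0 : MvPolynomial (Fin 2) k))
    rwa [map_mul, hg, ht, map_one, mul_comm] at this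
  rw [hz, hp, map_mul, hg, map_pow, mul_assoc, ← mul_pow, hinv, one_pow, mul_one]

/-! ### The two examples -/

theorem SystemRefutes.not_elkikTheoremUnder {A : Type u} [CommRing A] {I : Ideal A} {S : Set A}
    {α : AdicCompletion I A} (h : SystemRefutes I S α)
    {P : ∀ (A : Type u) [CommRing A], Ideal A → Prop} (hI : IsHenselianPair I) (hP : P A I) :
    ¬ ElkikTheoremUnder P := fun H => by
  obtain ⟨-, ⟨ε', -, hd, hn⟩, -⟩ := h
  exact hn (H A I hI hP _ _ ε' hd 1)

variable (k : Type u) [Field k] {A : Type u} [CommRing A] {I : Ideal A}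

theorem firstExample {φ : RingA₀ k →+* A} (h : IsHenselization (Ideal.span {tA₀ k}) I φ) :
    I = Ideal.span {φ (tA₀ k)} ∧ CondPrincipal A I ∧ CondNoetherianOutside A I ∧
      ∃ α : AdicCompletion I A,
        IsAdicSum I (fun i => φ (xA₀ k i) * φ (tA₀ k) ^ i) α ∧
        SystemRefutes I {φ (tA₀ k) - φ (yA₀ k), φ (tA₀ k) ^ 2} α := by
  have hI : I = Ideal.span {φ (tA₀ k)} := by
    rw [h.eq_map, Ideal.map_span, Set.image_singleton]
  have ht : φ (tA₀ k) ∈ I := hI ▸ Ideal.mem_span_singleton_self _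
  refine ⟨hI, ⟨φ (tA₀ k), hI⟩, ?_, ?_⟩
  · have := isNoetherianRing_away_tA₀ k
    exact ⟨RingA₀ k, inferInstance, φ.toAlgebra, _, isNoetherianOutside_span_singleton (tA₀ k),
      h.flat, h.eq_map⟩
  obtain ⟨α, hα⟩ := exists_isAdicSum (I := I) (a := fun i => φ (xA₀ k i) * φ (tA₀ k) ^ i)
    fun i => Ideal.mul_mem_left _ _ (Ideal.pow_mem_pow ht i)
  refine ⟨α, hα, systemRefutes (Set.toFinite _) ?_ ?_ fun β hβ hβα => ?_⟩
  · rw [hI, Ideal.span_singleton_le_iff_mem]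
    exact ⟨2, Ideal.subset_span (by simp)⟩
  · rintro a (rfl | rfl)
    · refine hα.algebraMap_mul_eq_zero (sub_mul_sum_mem (x := fun i => φ (xA₀ k i)) ht ?_ ?_)
      · rw [← map_mul, xA₀_zero_mul_yA₀, map_zero]
      · intro i
        rw [← map_mul, xA₀_succ_mul_yA₀]
    · refine hα.algebraMap_mul_eq_zero fun n => ?_
      rw [Finset.mul_sum]
      refine Ideal.sum_mem _ fun i _ => ?_
      rw [mul_left_comm, ← pow_add, ← map_pow, ← map_mul, add_comm 2, xA₀_mul_tA₀_pow, map_zero]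
      exact zero_mem _
  · have hs : φ (tA₀ k ^ 2) * β = 0 := by rw [map_pow]; exact hβ _ (by simp)
    have hr : φ (tA₀ k - yA₀ k) * β = 0 := by rw [map_sub]; exact hβ _ (by simp)
    obtain ⟨b, hb, hbx⟩ := h.exists_approximate_solution (sq_mul_torsionIdeal k)
      (fun _ => mem_torsionIdeal_of_sq_mul k) hs hr (x := xA₀ k 0) (by simpa using hα.sub_mem hβα)
    exact not_approximate_solution k hb hbx

theorem secondExample {φ : RingA₀' k →+* A}
    (h : IsHenselization (Ideal.span {tA₀' k, uA₀' k}) I φ) :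
    I = Ideal.span {φ (tA₀' k), φ (uA₀' k)} ∧ CondBoundedTorsion A I ∧
      ∃ α : AdicCompletion I A,
        IsAdicSum I (fun i => φ (xA₀' k i) * φ (tA₀' k) ^ i) α ∧
        SystemRefutes I {φ (tA₀' k) - φ (yA₀' k), φ (tA₀' k) ^ 2, φ (uA₀' k)} α := by
  have hI : I = Ideal.span {φ (tA₀' k), φ (uA₀' k)} := by
    rw [h.eq_map, Ideal.map_span, Set.image_pair]
  have ht : φ (tA₀' k) ∈ I := hI ▸ Ideal.subset_span (by simp)
  have hu : φ (uA₀' k) ∈ I := hI ▸ Ideal.subset_span (by simp)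
  refine ⟨hI, ⟨hI ▸ Submodule.fg_span (Set.toFinite _), 2, two_pos, ?_⟩, ?_⟩
  -- Torsion with respect to the single element `u` already lies in `T A`, which `I²` kills; hence
  -- the bound `2`.
  · have hle : idealTorsion I ≤ (torsionIdeal' k).map φ := fun a ha => by
      obtain ⟨m, -, hm⟩ : a ∈ elementTorsion (φ (uA₀' k)) :=
        (Submodule.mem_iInf _).1 ((Submodule.mem_iInf _).1 ha (φ (uA₀' k))) hu
      rw [← map_pow] at hm
      exact h.mem_map_of_mul_eq_zero (fun _ => mem_torsionIdeal'_of_pow_mul k) hm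
    rw [eq_bot_iff]
    refine (Ideal.mul_mono_right hle).trans ?_
    rw [h.eq_map, ← Ideal.map_pow, ← Ideal.map_mul, sq_mul_torsionIdeal', Ideal.map_bot]
  obtain ⟨α, hα⟩ := exists_isAdicSum (I := I) (a := fun i => φ (xA₀' k i) * φ (tA₀' k) ^ i)
    fun i => Ideal.mul_mem_left _ _ (Ideal.pow_mem_pow ht i)
  refine ⟨α, hα, systemRefutes (Set.toFinite _) ?_ ?_ fun β hβ hβα => ?_⟩
  · rw [hI, Ideal.span_le, Set.insert_subset_iff, Set.singleton_subset_iff]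
    exact ⟨⟨2, Ideal.subset_span (by simp)⟩, ⟨1, Ideal.subset_span (by simp)⟩⟩
  · rintro a (rfl | rfl | rfl)
    · refine hα.algebraMap_mul_eq_zero (sub_mul_sum_mem (x := fun i => φ (xA₀' k i)) ht ?_ ?_)
      · rw [← map_mul, xA₀'_zero_mul_yA₀', map_zero]
      · intro i
        rw [← map_mul, xA₀'_succ_mul_yA₀']
    · refine hα.algebraMap_mul_eq_zero fun n => ?_
      rw [Finset.mul_sum]
      refine Ideal.sum_mem _ fun i _ => ?_
      rw [mul_left_comm, ← pow_add, ← map_pow, ← map_mul, add_comm 2, xA₀'_mul_tA₀'_pow, map_zero]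
      exact zero_mem _
    · refine hα.algebraMap_mul_eq_zero fun n => ?_
      rw [Finset.mul_sum]
      refine Ideal.sum_mem _ fun i _ => ?_
      rw [mul_comm, ← map_pow, ← map_mul, ← map_mul, xA₀'_mul_tA₀'_pow_mul_uA₀', map_zero]
      exact zero_mem _
  -- Here the equation `u X = 0` takes over the role of `t² X = 0` in confining solutions to `T A`.
  · have hs : φ (uA₀' k ^ 1) * β = 0 := by rw [pow_one]; exact hβ _ (by simp)
    have hr : φ (tA₀' k - yA₀' k) * β = 0 := by rw [map_sub]; exact hβ _ (by simp)
    obtain ⟨b, hb, hbx⟩ := h.exists_approximate_solution (sq_mul_torsionIdeal' k)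
      (fun _ => mem_torsionIdeal'_of_pow_mul k) hs hr (x := xA₀' k 0)
      (by simpa using hα.sub_mem hβα)
    exact not_approximate_solution' k hb hbx

end

end ElkikApprox

theorem mainTheorem1 :
    -- Elkik's theorem is false under each one of the three weakened conditions.
    (¬ ElkikApprox.ElkikTheoremUnder.{u} ElkikApprox.CondPrincipal ∧
      ¬ ElkikApprox.ElkikTheoremUnder.{u} ElkikApprox.CondBoundedTorsion ∧
      ¬ ElkikApprox.ElkikTheoremUnder.{u} ElkikApprox.CondNoetherianOutside) ∧
    -- The first explicit counterexample, over any field.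
    (∀ (k : Type u) [Field k],
      (∃ (A : Type u) (_ : CommRing A) (I : Ideal A) (φ : ElkikApprox.RingA₀ k →+* A),
        ElkikApprox.IsHenselization (Ideal.span {ElkikApprox.tA₀ k}) I φ) ∧
      ∀ (A : Type u) [CommRing A] (I : Ideal A) (φ : ElkikApprox.RingA₀ k →+* A),
        ElkikApprox.IsHenselization (Ideal.span {ElkikApprox.tA₀ k}) I φ →
          I = Ideal.span {φ (ElkikApprox.tA₀ k)} ∧
          ElkikApprox.CondPrincipal A I ∧
          ElkikApprox.CondNoetherianOutside A I ∧
          ∃ α : AdicCompletion I A,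
            ElkikApprox.IsAdicSum I
              (fun i => φ (ElkikApprox.xA₀ k i) * φ (ElkikApprox.tA₀ k) ^ i) α ∧
            ElkikApprox.SystemRefutes I
              {φ (ElkikApprox.tA₀ k) - φ (ElkikApprox.yA₀ k), φ (ElkikApprox.tA₀ k) ^ 2} α) ∧
    -- The second explicit counterexample, over any field.
    (∀ (k : Type u) [Field k],
      (∃ (A : Type u) (_ : CommRing A) (I : Ideal A) (φ : ElkikApprox.RingA₀' k →+* A),
        ElkikApprox.IsHenselization
          (Ideal.span {ElkikApprox.tA₀' k, ElkikApprox.uA₀' k}) I φ) ∧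
      ∀ (A : Type u) [CommRing A] (I : Ideal A) (φ : ElkikApprox.RingA₀' k →+* A),
        ElkikApprox.IsHenselization
          (Ideal.span {ElkikApprox.tA₀' k, ElkikApprox.uA₀' k}) I φ →
          I = Ideal.span {φ (ElkikApprox.tA₀' k), φ (ElkikApprox.uA₀' k)} ∧
          ElkikApprox.CondBoundedTorsion A I ∧
          ∃ α : AdicCompletion I A,
            ElkikApprox.IsAdicSum I
              (fun i => φ (ElkikApprox.xA₀' k i) * φ (ElkikApprox.tA₀' k) ^ i) α ∧
            ElkikApprox.SystemRefutes I
              {φ (ElkikApprox.tA₀' k) - φ (ElkikApprox.yA₀' k), φ (ElkikApprox.tA₀' k) ^ 2,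
                φ (ElkikApprox.uA₀' k)} α) := by
  have exists_first := fun (k : Type u) [Field k] =>
    ElkikApprox.Henselization.isHenselization (Ideal.span {ElkikApprox.tA₀ k})
  have exists_second := fun (k : Type u) [Field k] =>
    ElkikApprox.Henselization.isHenselization
      (Ideal.span {ElkikApprox.tA₀' k, ElkikApprox.uA₀' k})
  refine ⟨⟨fun H => ?_, fun H => ?_, fun H => ?_⟩,
    fun k _ => ⟨⟨_, _, _, _, exists_first k⟩, fun A _ I φ h => ElkikApprox.firstExample k h⟩,
    fun k _ => ⟨⟨_, _, _, _, exists_second k⟩, fun A _ I φ h => ElkikApprox.secondExample k h⟩⟩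
  -- Any field in the universe `u` would serve here.
  · have h := exists_first (ULift.{u} ℚ)
    obtain ⟨-, hP, -, α, -, hα⟩ := ElkikApprox.firstExample _ h
    exact hα.not_elkikTheoremUnder h.1 hP H
  · have h := exists_second (ULift.{u} ℚ)
    obtain ⟨-, hP, α, -, hα⟩ := ElkikApprox.secondExample _ h
    exact hα.not_elkikTheoremUnder h.1 hP H
  · have h := exists_first (ULift.{u} ℚ)
    obtain ⟨-, -, hP, α, -, hα⟩ := ElkikApprox.firstExample _ h
    exact hα.not_elkikTheoremUnder h.1 hP H
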